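/- **Theorem (Myhill–Nerode theorem for hypergraphs).** Fix $t\in\mathbb N$. *Colored boundaried graphs.* A *2-colored $t$-boundaried graph* is a finite simple graph whose vertices are colored with colors in $\{1,2\}$ and which has $t$ distinct *boundary* vertices labeled $1,\dots,t$; two such graphs are regarded as the same if there is an isomorphism preserving colors and labels. Two of them are *color-compatible* if boundary vertices with the same label have the same color; then $G_1\oplus G_2$ is the 2-colored $t$-boundaried graph obtained from the disjoint union by identifying boundary vertices with the same label. The *parsing operators* are: the constants $\emptyset_{n_1,n_2}$ with $n_1+n_2=t$ ($t$ isolated boundary vertices, the first $n_1$ of color 1, the others of color 2); $e$ (add an edge between the vertices labeled 1 and 2); $u_1,u_2$ ($u_\ell$ adds a new isolated vertex of color $\ell$ and moves label 1 to it); $\gamma$ (move each label $j$ to the vertex labeled $j+1$, cyclically modulo $t$); $i$ (exchange labels 1 and 2); and the binary partial operator $\oplus$. (An operator that mentions label 1 or label 2 is present only if $t\ge1$, respectively $t\ge 2$.) Let $\mathcal U_2^{\rm small}$ be the set of 2-colored $t$-boundaried graphs that are values of expressions over these operators. The *parse tree* of such an expression is a rooted tree in which every node has at most two children and is labeled by an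 operator. *Boundaried hypergraphs.* A *$t$-boundaried hypergraph* is a finite hypergraph (hyperedges form a multiset; empty and singleton hyperedges are allowed) with $t$ distinct vertices and hyperedges labeled $1,\dots,t$; again two are regarded as the same if there is an isomorphism preserving labels. Two of them are *gluable* if no vertex of one has the label of a hyperedge of the other; then $H_1\oplus H_2$ is obtained from the disjoint union by identifying vertices with the same label and replacing hyperedges with the same label by their union. *Incidence graphs.* A *2-colored $t$-boundaried incidence graph* is a 2-colored $t$-boundaried graph in which no two vertices of the same color are adjacent. For such $G$ let $\mathcal H(G)$ be the $t$-boundaried hypergraph whose vertices are the color-1 vertices of $G$ and whose hyperedges are the neighborhoods $N(w)$ of the color-2 vertices $w$, with labels inherited from $G$. For a set $F$ of incidence graphs put $\mathcal H(F)=\{\mathcal H(G): G\in F\}$, and let $\mathcal H_t^{\rm small}$ be the set of all $\mathcal H(G)$ with $G\in\mathcal U_2^{\rm small}$ an incidence graph. A set $F\subseteq\mathcal U_2^{\rm small}$ of incidence graphs is *generator-total* if every incidence graph $G\in\mathcal U_2^{\rm small}$ with $\mathcal H(G)\in\mathcal H(F)$ belongs to $F$. *Congruences.* For a set $F$ of 2-colored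 $t$-boundaried graphs, $G_1\sim_F G_2$ means that $G_1,G_2$ are color-compatible and, for every 2-colored $t$-boundaried graph $H$ color-compatible with both, $G_1\oplus H\in F\iff G_2\oplus H\in F$. For a set $\mathcal F$ of $t$-boundaried hypergraphs, $H_1\sim_{\mathcal F}H_2$ means that $H_1,H_2$ are gluable and, for every $t$-boundaried hypergraph $H$ gluable to both, $H_1\oplus H\in\mathcal F\iff H_2\oplus H\in\mathcal F$. Such a relation has finite index over a set if it has finitely many equivalence classes on it. *Statement.* Let $\mathcal F\subseteq\mathcal H_t^{\rm small}$ be a hypergraph problem, that is, a set closed within $\mathcal H_t^{\rm small}$ under isomorphism of hypergraphs (isomorphisms need not respect the labels), and let $F\subseteq\mathcal U_2^{\rm small}$ be a generator-total set of 2-colored $t$-boundaried incidence graphs with $\mathcal F=\mathcal H(F)$. The following are equivalent: (i) there is a deterministic leaf-to-root finite tree automaton, reading rooted trees in which every node has at most two children and a label from the set of parsing operators, that accepts exactly the parse trees whose value is a graph in $F$; (ii) $\sim_{\mathcal F}$ has finite index over $\mathcal H_t^{\rm small}$; (iii) $\sim_F$ has finite index over $\mathcal U_2^{\rm small}$. 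-/

import Mathlib

namespace HyperMN

/-! ### Tree automata -/

/-- Rooted binary trees whose nodes are labelled by letters of `α`: every node has zero, one or
two children. -/
inductive LTree (α : Type) : Type
  | leaf (a : α) : LTree α
  | unary (a : α) (x : LTree α) : LTree α
  | binary (a : α) (x y : LTree α) : LTree α

/-- Deterministic leaf-to-root finite-state tree automata over the alphabet `α`. -/
structure TreeAutomaton (α : Type) where
  /-- the states -/
  Q : Type
  finite_Q : Finite Q
  /-- the transition function on `Σ × Q` -/
  δ₁ : α → Q → Q
  /-- the transition function on `Σ × Q × Q` -/
  δ₂ : α → Q → Q → Q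
  /-- the start state -/
  q₀ : Q
  /-- the final states -/
  final : Set Q

/-- The state of the automaton at the root of a tree. -/
def TreeAutomaton.state {α : Type} (A : TreeAutomaton α) : LTree α → A.Q
  | .leaf a => A.δ₁ a A.q₀
  | .unary a x => A.δ₁ a (A.state x)
  | .binary a x y => A.δ₂ a (A.state x) (A.state y)

/-- The automaton accepts a tree if its state at the root is final. -/
def TreeAutomaton.Accepts {α : Type} (A : TreeAutomaton α) (T : LTree α) : Prop :=
  A.state T ∈ A.final

/-- A tree language over a finite alphabet is recognizable if some finite tree automaton accepts
exactly the trees that belong to it. -/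
def Recognizable {α : Type} [Finite α] (L : Set (LTree α)) : Prop :=
  ∃ A : TreeAutomaton α, ∀ T : LTree α, A.Accepts T ↔ T ∈ L

/-! ### Finite index -/

/-- The equivalence relation `s` has finite index over `S`: it has only finitely many equivalence
classes on the members of `S`. -/
def FiniteIndexOver {X : Type*} (s : Setoid X) (S : Set X) : Prop :=
  Finite (Quotient (s.comap (Subtype.val : S → X)))

/-! ### Disjoint unions with identifications -/

/-- The disjoint union of `A` and `B` in which `a` and `b` are identified whenever `r a b`. It is
used for relations `r` that match some elements of `A` one-to-one with elements of `B`, so the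
result consists of `A` and of the unmatched elements of `B`. -/
abbrev Glued (A B : Type) (r : A → B → Prop) : Type :=
  A ⊕ {b : B // ∀ a, ¬ r a b}

/-- The canonical map from the first part. -/
def Glued.fst {A B : Type} (r : A → B → Prop) : A ↪ Glued A B r :=
  ⟨Sum.inl, Sum.inl_injective⟩

open Classical in
/-- The canonical map from the second part: a matched element goes to its partner. -/
noncomputable def Glued.snd {A B : Type} (r : A → B → Prop) (b : B) : Glued A B r :=
  if h : ∃ a, r a b then Sum.inl h.choose else Sum.inr ⟨b, not_exists.mp h⟩

theorem Glued.snd_injective {A B : Type} (r : A → B → Prop)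
    (hr : ∀ a b b', r a b → r a b' → b = b') : Function.Injective (Glued.snd r) := by
  intro b b' h
  unfold Glued.snd at h
  split_ifs at h with h1 h2 h2
  · have e : h1.choose = h2.choose := Sum.inl.inj h
    exact hr _ _ _ h1.choose_spec (e ▸ h2.choose_spec)
  · exact congrArg Subtype.val (Sum.inr.inj h)

/-! ### Two-colored `t`-boundaried graphs -/

/-- The two colors. -/
inductive Color : Type
  | one
  | two
  deriving DecidableEq

/-- Finite `{1,2}`-colored `t`-boundaried graphs. The boundary labels `1, …, t` are the elements
`0, …, t - 1` of `Fin t`, and they are carried by `t` distinct vertices. -/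
structure BGraph (t : ℕ) where
  V : Type
  finite_V : Finite V
  graph : SimpleGraph V
  color : V → Color
  lab : Fin t ↪ V

namespace BGraph

variable {t : ℕ}

/-- Isomorphism respecting colors and boundary labels. Boundaried graphs that are related in
this way are regarded as the same boundaried graph. -/
def LabIso (G H : BGraph t) : Prop :=
  ∃ f : G.graph ≃g H.graph, (∀ v, H.color (f v) = G.color v) ∧ ∀ i, f (G.lab i) = H.lab i

/-- Color-compatibility: boundary vertices with the same label have the same color. -/
def Compatible (G H : BGraph t) : Prop :=
  ∀ i, G.color (G.lab i) = H.color (H.lab i)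

/-- A boundary vertex of `G` and a boundary vertex of `H` carry the same label. -/
def SameLabel (G H : BGraph t) (v : G.V) (w : H.V) : Prop :=
  ∃ i, G.lab i = v ∧ H.lab i = w

/-- The vertices of `H` inside the glued graph. -/
noncomputable def glueSnd (G H : BGraph t) : H.V ↪ Glued G.V H.V (SameLabel G H) :=
  ⟨Glued.snd _, Glued.snd_injective _ (by
    rintro a b b' ⟨i, hi, rfl⟩ ⟨j, hj, rfl⟩
    rw [G.lab.injective (hi.trans hj.symm)])⟩

/-- The glued graph of `G` and `H`, which is used for color-compatible graphs only: the disjoint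
union in which boundary vertices with the same label are identified. -/
noncomputable def glue (G H : BGraph t) : BGraph t where
  V := Glued G.V H.V (SameLabel G H)
  finite_V := by
    have := G.finite_V
    have := H.finite_V
    infer_instance
  graph := G.graph.map (Glued.fst _) ⊔ H.graph.map (glueSnd G H)
  color := Sum.elim G.color (fun w => H.color w.1)
  lab := G.lab.trans (Glued.fst _)

/-- `t` isolated boundary vertices, the first `n` of color 1 and the other `t - n` of color 2. -/
def empty (n : Fin (t + 1)) : BGraph t where
  V := Fin t
  finite_V := inferInstance
  graph := ⊥
  color := fun j => if (j : ℕ) < n then Color.one else Color.two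
  lab := Function.Embedding.refl _

/-- Add an edge between the boundary vertices labelled 1 and 2. -/
def addEdge (h : 2 ≤ t) (G : BGraph t) : BGraph t where
  V := G.V
  finite_V := G.finite_V
  graph := G.graph ⊔ SimpleGraph.edge (G.lab ⟨0, by omega⟩) (G.lab ⟨1, by omega⟩)
  color := G.color
  lab := G.lab

/-- Add a new isolated vertex of color `l` and give it the label 1, unlabelling the vertex that
carried this label. -/
def newVertex (h : 1 ≤ t) (l : Color) (G : BGraph t) : BGraph t where
  V := Option G.V
  finite_V := by
    have := G.finite_V
    infer_instance
  graph := G.graph.map Function.Embedding.some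
  color := fun v => v.elim l G.color
  lab := ⟨fun j => if j = ⟨0, h⟩ then none else some (G.lab j), by
    intro i j hij
    dsimp only at hij
    split_ifs at hij with h1 h2 h2
    · exact h1.trans h2.symm
    · exact G.lab.injective (Option.some.inj hij)⟩

/-- Move each label `j` to the vertex labelled `j + 1` modulo `t`. -/
def shift (G : BGraph t) : BGraph t where
  V := G.V
  finite_V := G.finite_V
  graph := G.graph
  color := G.color
  lab := (finRotate t).toEmbedding.trans G.lab

/-- Exchange the labels 1 and 2. -/
def swap (h : 2 ≤ t) (G : BGraph t) : BGraph t where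
  V := G.V
  finite_V := G.finite_V
  graph := G.graph
  color := G.color
  lab := (Equiv.swap (⟨0, by omega⟩ : Fin t) ⟨1, by omega⟩).toEmbedding.trans G.lab

/-- Two-colored `t`-boundaried incidence graphs: each color class is an independent set. -/
def IsIncidence (G : BGraph t) : Prop :=
  ∀ v w, G.graph.Adj v w → G.color v ≠ G.color w

end BGraph

/-- The size-`t` parsing operators for two colors. An operator that mentions label 1 or label 2
exists only if `t` is large enough for these labels to exist. -/
inductive ParseOp (t : ℕ) : Type
  | empty (n : Fin (t + 1)) : ParseOp t
  | edge (h : 2 ≤ t) : ParseOp t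
  | newVertex (h : 1 ≤ t) (l : Color) : ParseOp t
  | shift : ParseOp t
  | swap (h : 2 ≤ t) : ParseOp t
  | glue : ParseOp t

instance (t : ℕ) : Finite (ParseOp t) := by
  let f : (Fin (t + 1) ⊕ Bool) ⊕ Fin 4 → Option (ParseOp t) := fun x =>
    match x with
    | .inl (.inl n) => some (.empty n)
    | .inl (.inr b) =>
      if h : 1 ≤ t then some (.newVertex h (if b then Color.one else Color.two)) else none
    | .inr 0 => if h : 2 ≤ t then some (.edge h) else none
    | .inr 1 => some .shift
    | .inr 2 => if h : 2 ≤ t then some (.swap h) else none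
    | .inr 3 => some .glue
  have hf : ∀ a : ParseOp t, ∃ x, f x = some a := by
    intro a
    cases a with
    | empty n => exact ⟨.inl (.inl n), rfl⟩
    | edge h => exact ⟨.inr 0, by simp [f, h]⟩
    | newVertex h l =>
      cases l with
      | one => exact ⟨.inl (.inr true), by simp [f, h]⟩
      | two => exact ⟨.inl (.inr false), by simp [f, h]⟩
    | shift => exact ⟨.inr 1, rfl⟩
    | swap h => exact ⟨.inr 2, by simp [f, h]⟩
    | glue => exact ⟨.inr 3, rfl⟩
  choose g hg using hf
  exact Finite.of_injective g fun a b hab =>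
    Option.some.inj ((hg a).symm.trans ((congrArg f hab).trans (hg b)))

open Classical in
/-- The value of the expression with a given parse tree; `none` if the tree is not the parse tree
of an expression (a node has the wrong number of children) or if it glues two graphs that are not
color-compatible. -/
noncomputable def value {t : ℕ} : LTree (ParseOp t) → Option (BGraph t)
  | .leaf (.empty n) => some (BGraph.empty n)
  | .unary (.edge h) x => (value x).map (BGraph.addEdge h)
  | .unary (.newVertex h l) x => (value x).map (BGraph.newVertex h l)
  | .unary .shift x => (value x).map BGraph.shift
  | .unary (.swap h) x => (value x).map (BGraph.swap h)
  | .binary .glue x y =>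
    (value x).bind fun G => (value y).bind fun H =>
      if G.Compatible H then some (G.glue H) else none
  | _ => none

/-- The small universe: the boundaried graphs generated by the parsing operators. -/
def USmall (t : ℕ) : Set (BGraph t) :=
  {G | ∃ (T : LTree (ParseOp t)) (K : BGraph t), value T = some K ∧ G.LabIso K}

/-- The parse trees generating the graphs in `F`. -/
def parseTrees {t : ℕ} (F : Set (BGraph t)) : Set (LTree (ParseOp t)) :=
  {T | ∃ G ∈ F, value T = some G}

/-- The canonical right congruence of a graph problem `F`, on the large universe of all
two-colored `t`-boundaried graphs. -/
def graphCongruence {t : ℕ} (F : Set (BGraph t)) : Setoid (BGraph t) where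
  r G₁ G₂ := G₁.Compatible G₂ ∧
    ∀ H : BGraph t, G₁.Compatible H → G₂.Compatible H → (G₁.glue H ∈ F ↔ G₂.glue H ∈ F)
  iseqv :=
    { refl := fun _ => ⟨fun _ => rfl, fun _ _ _ => Iff.rfl⟩
      symm := fun h => ⟨fun i => (h.1 i).symm, fun H h₁ h₂ => (h.2 H h₂ h₁).symm⟩
      trans := fun h k => ⟨fun i => (h.1 i).trans (k.1 i), fun H h₁ h₃ =>
        (h.2 H h₁ fun i => (h.1 i).symm.trans (h₁ i)).trans
          (k.2 H (fun i => (h.1 i).symm.trans (h₁ i)) h₃)⟩ }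

/-! ### `t`-boundaried hypergraphs -/

/-- Finite `t`-boundaried hypergraphs. The multiset of hyperedges is given as a family of vertex
sets; the labels are carried by `t` distinct vertices and hyperedges. -/
structure BHyper (t : ℕ) where
  V : Type
  E : Type
  finite_V : Finite V
  finite_E : Finite E
  edge : E → Set V
  lab : Fin t ↪ V ⊕ E

namespace BHyper

variable {t : ℕ}

/-- Hypergraph isomorphism, which ignores the labels. -/
def Iso (H K : BHyper t) : Prop :=
  ∃ (f : H.V ≃ K.V) (g : H.E ≃ K.E), ∀ e, K.edge (g e) = f '' H.edge e

/-- Isomorphism respecting the boundary labels. Boundaried hypergraphs that are related in this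
way are regarded as the same boundaried hypergraph. -/
def LabIso (H K : BHyper t) : Prop :=
  ∃ (f : H.V ≃ K.V) (g : H.E ≃ K.E), (∀ e, K.edge (g e) = f '' H.edge e) ∧
    ∀ i, Sum.map f g (H.lab i) = K.lab i

/-- No vertex of one hypergraph has the label of a hyperedge of the other. -/
def Gluable (H K : BHyper t) : Prop :=
  ∀ i, ¬ ((H.lab i).isLeft ∧ (K.lab i).isRight) ∧ ¬ ((H.lab i).isRight ∧ (K.lab i).isLeft)

/-- A vertex of `H` and a vertex of `K` carry the same label. -/
def SameLabelV (H K : BHyper t) (v : H.V) (w : K.V) : Prop :=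
  ∃ i, H.lab i = Sum.inl v ∧ K.lab i = Sum.inl w

/-- A hyperedge of `H` and a hyperedge of `K` carry the same label. -/
def SameLabelE (H K : BHyper t) (d : H.E) (e : K.E) : Prop :=
  ∃ i, H.lab i = Sum.inr d ∧ K.lab i = Sum.inr e

/-- The glued hypergraph of `H` and `K`, which is used for gluable hypergraphs only: the disjoint
union in which vertices with the same label are identified and hyperedges with the same label are
replaced by their union. -/
noncomputable def glue (H K : BHyper t) : BHyper t where
  V := Glued H.V K.V (SameLabelV H K)
  E := Glued H.E K.E (SameLabelE H K)
  finite_V := by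
    have := H.finite_V
    have := K.finite_V
    infer_instance
  finite_E := by
    have := H.finite_E
    have := K.finite_E
    infer_instance
  edge x := {v |
    (∃ d, Glued.fst _ d = x ∧ v ∈ Glued.fst (SameLabelV H K) '' H.edge d) ∨
    (∃ e, Glued.snd _ e = x ∧ v ∈ Glued.snd (SameLabelV H K) '' K.edge e)}
  lab := H.lab.trans ((Glued.fst _).sumMap (Glued.fst _))

end BHyper

/-- The canonical right congruence of a hypergraph problem `𝓕`, on the large universe of all
`t`-boundaried hypergraphs. -/
def hyperCongruence {t : ℕ} (𝓕 : Set (BHyper t)) : Setoid (BHyper t) where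
  r H₁ H₂ := H₁.Gluable H₂ ∧
    ∀ H : BHyper t, H₁.Gluable H → H₂.Gluable H → (H₁.glue H ∈ 𝓕 ↔ H₂.glue H ∈ 𝓕)
  iseqv := by
    have key : ∀ H K : BHyper t, H.Gluable K ↔ ∀ i, (H.lab i).isLeft = (K.lab i).isLeft := by
      intro H K
      refine forall_congr' fun i => ?_
      rcases H.lab i with v | d <;> rcases K.lab i with w | e <;> simp
    constructor
    · intro H
      exact ⟨(key _ _).2 fun _ => rfl, fun _ _ _ => Iff.rfl⟩
    · intro H K h
      exact ⟨(key _ _).2 fun i => ((key _ _).1 h.1 i).symm, fun M h₁ h₂ => (h.2 M h₂ h₁).symm⟩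
    · intro H K M h k
      refine ⟨(key _ _).2 fun i => ((key _ _).1 h.1 i).trans ((key _ _).1 k.1 i), fun N h₁ h₃ => ?_⟩
      have h₂ : K.Gluable N :=
        (key _ _).2 fun i => ((key _ _).1 h.1 i).symm.trans ((key _ _).1 h₁ i)
      exact (h.2 N h₁ h₂).trans (k.2 N h₂ h₃)

/-! ### Hypergraphs represented by their incidence graphs -/

/-- The boundaried hypergraph represented by a two-colored boundaried incidence graph: its vertices
are the vertices of color 1, its hyperedges are the neighborhoods of the vertices of color 2, and
labels are inherited. (A color different from 1 is 2.) -/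
def BGraph.toHyper {t : ℕ} (G : BGraph t) : BHyper t where
  V := {v : G.V // G.color v = Color.one}
  E := {w : G.V // ¬ G.color w = Color.one}
  finite_V := by
    have := G.finite_V
    infer_instance
  finite_E := by
    have := G.finite_V
    infer_instance
  edge w := {u | G.graph.Adj w.1 u.1}
  lab := G.lab.trans (Equiv.sumCompl fun v => G.color v = Color.one).symm.toEmbedding

/-- The set of boundaried hypergraphs represented by the incidence graphs in `F`. -/
def hyperOf {t : ℕ} (F : Set (BGraph t)) : Set (BHyper t) :=
  {H | ∃ G ∈ F, G.IsIncidence ∧ H.LabIso G.toHyper}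

/-- The small universe of boundaried hypergraphs: those represented by generated incidence
graphs. -/
def HSmall (t : ℕ) : Set (BHyper t) :=
  hyperOf (USmall t)

/-- `F` contains every generated incidence graph that represents a hypergraph represented by a
member of `F`. -/
def GeneratorTotal {t : ℕ} (F : Set (BGraph t)) : Prop :=
  ∀ G ∈ USmall t, G.IsIncidence → G.toHyper ∈ hyperOf F → G ∈ F

end HyperMN

/-!
The equivalence rests on two observations about the generated graphs.

*Only generated contexts matter.* If a boundaried graph maps injectively, respecting edges and
labels, into a generated graph, then it is generated (`USmall.of_injective_hom`); in particular
both parts of a generated glued graph are generated (`USmall.of_glue`). The congruence of `F`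
quantifies over all contexts `H`, but `G ⊕ H ∈ F ⊆ USmall t` forces `H` to be, up to isomorphism, the
value of a parse tree. So an automaton that accepts the parse trees of `F` tells the classes apart: the state of a
parse tree of `G` together with the colors of the boundary of `G` determines which contexts
complete `G` to a member of `F` (`finiteIndexOver_of_recognizable`).

*Operators have adjoints.* Conversely, the classes are the states of an automaton once the
congruence is compatible with the operators. An operator applied to `G` in `G ⊕ H` can be moved over
to the context `H`: adding an edge, permuting labels, gluing with a third graph, and also adding a
new vertex, where `u_l(G) ⊕ H` and `G ⊕ u_c(H)` are isomorphic if `c` is the color of the vertex of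
`G` labelled 1 (`newVertex_glue`). The last isomorphism does not respect the labels, and this is
where the invariance of hypergraph problems under isomorphisms that ignore the labels is used, in
the form `IsoClosed F`; it applies only to generated graphs, which is harmless by the first
observation.

For hypergraphs, taking incidence graphs commutes with gluing (`BHyper.incidence_glue`) and inverts
`toHyper` on incidence graphs, so the two congruences correspond (`hyperCongruence_iff`). Graphs that
are not incidence graphs add at most one class for each coloring of the boundary, because gluing
never repairs them.
-/

namespace HyperMN

namespace BGraph

variable {t : ℕ}

/-! ### Isomorphisms -/

/-- Isomorphism of colored graphs, which ignores the boundary labels. -/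
def Iso (G H : BGraph t) : Prop :=
  ∃ f : G.graph ≃g H.graph, ∀ v, H.color (f v) = G.color v

theorem LabIso.iso {G H : BGraph t} (h : G.LabIso H) : G.Iso H :=
  let ⟨f, hf, _⟩ := h
  ⟨f, hf⟩

theorem Iso.symm {G H : BGraph t} (h : G.Iso H) : H.Iso G := by
  obtain ⟨f, hf⟩ := h
  exact ⟨f.symm, fun v => by rw [← hf, f.apply_symm_apply]⟩

theorem Iso.isIncidence {G H : BGraph t} (h : G.Iso H) (hG : G.IsIncidence) :
    H.IsIncidence := by
  obtain ⟨f, hf⟩ := h.symm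
  intro v w hvw
  rw [← hf, ← hf]
  exact hG _ _ (f.map_adj_iff.2 hvw)

theorem LabIso.refl (G : BGraph t) : G.LabIso G :=
  ⟨SimpleGraph.Iso.refl, fun _ => rfl, fun _ => rfl⟩

theorem LabIso.symm {G H : BGraph t} (h : G.LabIso H) : H.LabIso G := by
  obtain ⟨f, hf, hl⟩ := h
  exact ⟨f.symm, fun v => by rw [← hf, f.apply_symm_apply],
    fun i => by rw [← hl, f.symm_apply_apply]⟩

theorem LabIso.trans {G H K : BGraph t} (h : G.LabIso H) (k : H.LabIso K) : G.LabIso K := by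
  obtain ⟨f, hf, hl⟩ := h
  obtain ⟨g, hg, hm⟩ := k
  exact ⟨f.trans g, fun v => by simp [hf, hg], fun i => by simp [hl, hm]⟩

theorem Compatible.symm {G H : BGraph t} (h : G.Compatible H) : H.Compatible G :=
  fun i => (h i).symm

theorem Compatible.trans {G H K : BGraph t} (h : G.Compatible H) (k : H.Compatible K) :
    G.Compatible K :=
  fun i => (h i).trans (k i)

theorem LabIso.compatible {G H : BGraph t} (h : G.LabIso H) : G.Compatible H := by
  obtain ⟨f, hf, hl⟩ := h
  intro i
  rw [← hl, hf]

/-- Permuting the boundary labels. -/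
def relabel (σ : Equiv.Perm (Fin t)) (G : BGraph t) : BGraph t where
  V := G.V
  finite_V := G.finite_V
  graph := G.graph
  color := G.color
  lab := σ.toEmbedding.trans G.lab

/-- `t` isolated boundary vertices of prescribed colors. -/
def discrete (c : Fin t → Color) : BGraph t where
  V := Fin t
  finite_V := inferInstance
  graph := ⊥
  color := c
  lab := Function.Embedding.refl _

theorem relabel_lab (σ : Equiv.Perm (Fin t)) (G : BGraph t) (i : Fin t) :
    (G.relabel σ).lab i = G.lab (σ i) :=
  rfl

theorem LabIso.relabel {G H : BGraph t} (σ : Equiv.Perm (Fin t)) (h : G.LabIso H) :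
    (G.relabel σ).LabIso (H.relabel σ) := by
  obtain ⟨f, hf, hl⟩ := h
  exact ⟨f, hf, fun i => hl (σ i)⟩

theorem addEdge_adj (ht : 2 ≤ t) (G : BGraph t) (v w : G.V) :
    (G.addEdge ht).graph.Adj v w ↔ G.graph.Adj v w ∨
      (v = G.lab ⟨0, by omega⟩ ∧ w = G.lab ⟨1, by omega⟩) ∨
      (v = G.lab ⟨1, by omega⟩ ∧ w = G.lab ⟨0, by omega⟩) := by
  have h01 : G.lab ⟨0, by omega⟩ ≠ G.lab ⟨1, by omega⟩ := fun h => by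
    simpa using G.lab.injective h
  change (G.graph ⊔ SimpleGraph.edge _ _).Adj v w ↔ _
  rw [SimpleGraph.sup_adj, SimpleGraph.edge_adj]
  constructor
  · rintro (h | ⟨h, -⟩)
    · exact .inl h
    · exact .inr h
  · rintro (h | ⟨rfl, rfl⟩ | ⟨rfl, rfl⟩)
    · exact .inl h
    · exact .inr ⟨.inl ⟨rfl, rfl⟩, h01⟩
    · exact .inr ⟨.inr ⟨rfl, rfl⟩, h01.symm⟩

/-- The vertices of `G` inside `G.newVertex ht l`. -/
def newVertexOld (ht : 1 ≤ t) (l : Color) (G : BGraph t) (v : G.V) : (G.newVertex ht l).V :=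
  some v

/-- The isolated vertex that `newVertex` adds. -/
def newVertexNew (ht : 1 ≤ t) (l : Color) (G : BGraph t) : (G.newVertex ht l).V :=
  none

theorem newVertex_cases (ht : 1 ≤ t) (l : Color) (G : BGraph t) (v : (G.newVertex ht l).V) :
    v = newVertexNew ht l G ∨ ∃ a, v = newVertexOld ht l G a := by
  rcases v with _ | a
  · exact .inl rfl
  · exact .inr ⟨a, rfl⟩

theorem newVertexOld_injective (ht : 1 ≤ t) (l : Color) (G : BGraph t) :
    Function.Injective (newVertexOld ht l G) :=
  Option.some_injective _

theorem newVertexOld_ne (ht : 1 ≤ t) (l : Color) (G : BGraph t) (v : G.V) :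
    newVertexOld ht l G v ≠ newVertexNew ht l G :=
  Option.some_ne_none v

theorem newVertex_adj (ht : 1 ≤ t) (l : Color) (G : BGraph t) (v w : (G.newVertex ht l).V) :
    (G.newVertex ht l).graph.Adj v w ↔
      ∃ a b, G.graph.Adj a b ∧ newVertexOld ht l G a = v ∧ newVertexOld ht l G b = w :=
  SimpleGraph.map_adj Function.Embedding.some G.graph v w

theorem newVertex_lab_zero (ht : 1 ≤ t) (l : Color) (G : BGraph t) :
    (G.newVertex ht l).lab ⟨0, ht⟩ = newVertexNew ht l G := by
  change (if (⟨0, ht⟩ : Fin t) = ⟨0, ht⟩ then none else some (G.lab ⟨0, ht⟩)) = none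
  exact if_pos rfl

theorem newVertex_lab_of_ne (ht : 1 ≤ t) (l : Color) (G : BGraph t) {i : Fin t}
    (hi : i ≠ ⟨0, ht⟩) : (G.newVertex ht l).lab i = newVertexOld ht l G (G.lab i) :=
  if_neg hi

theorem LabIso.addEdge {G H : BGraph t} (ht : 2 ≤ t) (h : G.LabIso H) :
    (G.addEdge ht).LabIso (H.addEdge ht) := by
  obtain ⟨f, hf, hl⟩ := h
  refine ⟨⟨f.toEquiv, ?_⟩, hf, hl⟩
  intro a b
  refine (addEdge_adj ht H (f a) (f b)).trans (Iff.trans ?_ (addEdge_adj ht G a b).symm)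
  rw [← hl, ← hl]
  have h2 {x y : G.V} : f x = f y ↔ x = y := f.injective.eq_iff
  exact or_congr f.map_adj_iff (or_congr (and_congr h2 h2) (and_congr h2 h2))

theorem LabIso.newVertex {G H : BGraph t} (ht : 1 ≤ t) (l : Color) (h : G.LabIso H) :
    (G.newVertex ht l).LabIso (H.newVertex ht l) := by
  obtain ⟨f, hf, hl⟩ := h
  refine ⟨⟨f.toEquiv.optionCongr, ?_⟩, ?_, ?_⟩
  · intro x y
    refine (newVertex_adj ht l H _ _).trans (Iff.trans ?_ (newVertex_adj ht l G x y).symm)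
    constructor
    · rintro ⟨a, b, hab, ha, hb⟩
      refine ⟨f.symm a, f.symm b, f.symm.map_adj_iff.2 hab, ?_, ?_⟩
      · exact f.toEquiv.optionCongr.injective
          ((congrArg some (f.apply_symm_apply a)).trans ha)
      · exact f.toEquiv.optionCongr.injective
          ((congrArg some (f.apply_symm_apply b)).trans hb)
    · rintro ⟨a, b, hab, rfl, rfl⟩
      exact ⟨f a, f b, f.map_adj_iff.2 hab, rfl, rfl⟩
  · rintro (_ | a)
    · rfl
    · exact hf a
  · intro i
    by_cases hi : i = ⟨0, ht⟩
    · rw [hi, newVertex_lab_zero, newVertex_lab_zero]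
      rfl
    · rw [newVertex_lab_of_ne _ _ _ hi, newVertex_lab_of_ne _ _ _ hi, ← hl]
      rfl

/-! ### Gluing up to isomorphism -/

/-- The maps `f` and `g` exhibit the colored graph of `X` as the graph obtained from the disjoint
union of `A` and `B` by identifying boundary vertices with the same label. The boundary of `X`
plays no role. -/
structure IsGluing (A B X : BGraph t) (f : A.V → X.V) (g : B.V → X.V) : Prop where
  injective_fst : Function.Injective f
  injective_snd : Function.Injective g
  eq_iff : ∀ a b, f a = g b ↔ A.SameLabel B a b
  surj : ∀ x, (∃ a, f a = x) ∨ ∃ b, g b = x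
  map_fst : ∀ {a a'}, A.graph.Adj a a' → X.graph.Adj (f a) (f a')
  map_snd : ∀ {b b'}, B.graph.Adj b b' → X.graph.Adj (g b) (g b')
  adj : ∀ {x y}, X.graph.Adj x y → (∃ a a', A.graph.Adj a a' ∧ f a = x ∧ f a' = y) ∨
    ∃ b b', B.graph.Adj b b' ∧ g b = x ∧ g b' = y
  color_fst : ∀ a, X.color (f a) = A.color a
  color_snd : ∀ b, X.color (g b) = B.color b

/-- The vertices of `A` inside the glued graph. -/
def glueInl (A B : BGraph t) (a : A.V) : (A.glue B).V :=
  Sum.inl a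

/-- The vertices of `B` inside the glued graph. -/
noncomputable def glueInr (A B : BGraph t) (b : B.V) : (A.glue B).V :=
  A.glueSnd B b

theorem glueInr_of_lab (A B : BGraph t) (i : Fin t) :
    A.glueInr B (B.lab i) = A.glueInl B (A.lab i) := by
  have h : ∃ a, A.SameLabel B a (B.lab i) := ⟨_, i, rfl, rfl⟩
  have h1 : A.glueInr B (B.lab i) = A.glueInl B h.choose := dif_pos h
  rw [h1]
  obtain ⟨j, hj, hj'⟩ := h.choose_spec
  rw [← hj, B.lab.injective hj']

theorem glueInr_of_not (A B : BGraph t) (b : B.V) (h : ∀ a, ¬ A.SameLabel B a b) :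
    A.glueInr B b = (Sum.inr ⟨b, h⟩ : Glued _ _ _) :=
  dif_neg (by simpa using h)

theorem glueInr_cases (A B : BGraph t) (b : B.V) :
    (∃ i, B.lab i = b ∧ A.glueInr B b = A.glueInl B (A.lab i)) ∨
    ∃ h, A.glueInr B b = (Sum.inr ⟨b, h⟩ : Glued _ _ _) := by
  by_cases h : ∃ a, A.SameLabel B a b
  · obtain ⟨a, i, rfl, rfl⟩ := h
    exact .inl ⟨i, rfl, glueInr_of_lab A B i⟩
  · exact .inr ⟨not_exists.1 h, glueInr_of_not A B b _⟩

theorem glue_adj (A B : BGraph t) (x y : (A.glue B).V) :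
    (A.glue B).graph.Adj x y ↔ (∃ a a', A.graph.Adj a a' ∧ A.glueInl B a = x ∧ A.glueInl B a' = y) ∨
      ∃ b b', B.graph.Adj b b' ∧ A.glueInr B b = x ∧ A.glueInr B b' = y :=
  or_congr (SimpleGraph.map_adj _ _ _ _) (SimpleGraph.map_adj _ _ _ _)

theorem isGluing_glue {A B : BGraph t} (h : A.Compatible B) :
    IsGluing A B (A.glue B) (A.glueInl B) (A.glueInr B) where
  injective_fst := Sum.inl_injective
  injective_snd := (A.glueSnd B).injective
  eq_iff a b := by
    constructor
    · intro hab
      obtain ⟨i, hi, hi'⟩ | ⟨hb, hi'⟩ := glueInr_cases A B b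
      · exact ⟨i, (Sum.inl_injective (hab.trans hi')).symm, hi⟩
      · exact absurd (hab.trans hi') Sum.inl_ne_inr
    · rintro ⟨i, rfl, rfl⟩
      exact (glueInr_of_lab A B i).symm
  surj x := by
    rcases x with a | ⟨b, hb⟩
    · exact .inl ⟨a, rfl⟩
    · exact .inr ⟨b, glueInr_of_not A B b hb⟩
  map_fst haa := (glue_adj A B _ _).2 (.inl ⟨_, _, haa, rfl, rfl⟩)
  map_snd hbb := (glue_adj A B _ _).2 (.inr ⟨_, _, hbb, rfl, rfl⟩)
  adj hxy := (glue_adj A B _ _).1 hxy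
  color_fst _ := rfl
  color_snd b := by
    obtain ⟨i, hi, hi'⟩ | ⟨hb, hi'⟩ := glueInr_cases A B b
    · rw [hi', ← hi, ← h i]
      rfl
    · rw [hi']
      rfl

theorem IsGluing.symm {A B X : BGraph t} {f : A.V → X.V} {g : B.V → X.V}
    (h : IsGluing A B X f g) : IsGluing B A X g f where
  injective_fst := h.injective_snd
  injective_snd := h.injective_fst
  eq_iff b a := by
    rw [eq_comm, h.eq_iff]
    exact exists_congr fun _ => and_comm
  surj x := (h.surj x).symm
  map_fst := h.map_snd
  map_snd := h.map_fst
  adj hxy := (h.adj hxy).symm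
  color_fst := h.color_snd
  color_snd := h.color_fst

theorem IsGluing.fst_lab {A B X : BGraph t} {f : A.V → X.V} {g : B.V → X.V}
    (h : IsGluing A B X f g) (i : Fin t) : f (A.lab i) = g (B.lab i) :=
  (h.eq_iff _ _).2 ⟨i, rfl, rfl⟩

theorem IsGluing.compatible {A B X : BGraph t} {f : A.V → X.V} {g : B.V → X.V}
    (h : IsGluing A B X f g) : A.Compatible B := fun i => by
  rw [← h.color_fst, ← h.color_snd, h.fst_lab]

/-- Gluings are unique up to isomorphism. -/
theorem IsGluing.exists_iso {A B X : BGraph t} {f : A.V → X.V} {g : B.V → X.V}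
    (h : IsGluing A B X f g) :
    ∃ e : (A.glue B).graph ≃g X.graph, (∀ v, X.color (e v) = (A.glue B).color v) ∧
      ∀ a, e (A.glueInl B a) = f a := by
  have hG := isGluing_glue h.compatible
  let e₀ : (A.glue B).V → X.V := Sum.elim f (fun b => g b.1)
  have h1 : ∀ a, e₀ (A.glueInl B a) = f a := fun _ => rfl
  have h2 : ∀ b, e₀ (A.glueInr B b) = g b := by
    intro b
    obtain ⟨i, rfl, hi⟩ | ⟨hb, hi⟩ := glueInr_cases A B b
    · rw [hi, h1, h.fst_lab]
    · rw [hi]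
      rfl
  have hinj : Function.Injective e₀ := by
    intro x y hxy
    obtain ⟨a, rfl⟩ | ⟨a, rfl⟩ := hG.surj x <;> obtain ⟨b, rfl⟩ | ⟨b, rfl⟩ := hG.surj y
    · exact congrArg _ (h.injective_fst hxy)
    · rw [h1, h2] at hxy
      exact (hG.eq_iff _ _).2 ((h.eq_iff _ _).1 hxy)
    · rw [h1, h2] at hxy
      exact ((hG.eq_iff _ _).2 ((h.eq_iff _ _).1 hxy.symm)).symm
    · rw [h2, h2] at hxy
      exact congrArg _ (h.injective_snd hxy)
  have hsurj : Function.Surjective e₀ := by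
    intro x
    obtain ⟨a, rfl⟩ | ⟨b, rfl⟩ := h.surj x
    · exact ⟨_, h1 a⟩
    · exact ⟨_, h2 b⟩
  refine ⟨⟨Equiv.ofBijective e₀ ⟨hinj, hsurj⟩, ?_⟩, ?_, h1⟩
  · intro x y
    change X.graph.Adj (e₀ x) (e₀ y) ↔ _
    constructor
    · intro hxy
      obtain ⟨a, a', haa, hx, hy⟩ | ⟨b, b', hbb, hx, hy⟩ := h.adj hxy
      · rw [← hinj ((h1 a).trans hx), ← hinj ((h1 a').trans hy)]
        exact hG.map_fst haa
      · rw [← h2] at hx hy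
        rw [← hinj hx, ← hinj hy]
        exact hG.map_snd hbb
    · intro hxy
      obtain ⟨a, a', haa, rfl, rfl⟩ | ⟨b, b', hbb, rfl, rfl⟩ := hG.adj hxy
      · exact h.map_fst haa
      · rw [h2, h2]
        exact h.map_snd hbb
  · intro x
    change X.color (e₀ x) = _
    obtain ⟨a, rfl⟩ | ⟨b, rfl⟩ := hG.surj x
    · rw [h1, h.color_fst, hG.color_fst]
    · rw [h2, h.color_snd, hG.color_snd]

theorem IsGluing.iso {A B X : BGraph t} {f : A.V → X.V} {g : B.V → X.V}
    (h : IsGluing A B X f g) : (A.glue B).Iso X :=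
  let ⟨e, he, _⟩ := h.exists_iso
  ⟨e, he⟩

theorem IsGluing.labIso {A B X : BGraph t} {f : A.V → X.V} {g : B.V → X.V}
    (h : IsGluing A B X f g) (hl : ∀ i, f (A.lab i) = X.lab i) : (A.glue B).LabIso X :=
  let ⟨e, he, hf⟩ := h.exists_iso
  ⟨e, he, fun i => (hf _).trans (hl i)⟩

theorem LabIso.glue_left {A A' B : BGraph t} (h : A.LabIso A') (hB : A.Compatible B) :
    (A.glue B).LabIso (A'.glue B) := by
  have hG := isGluing_glue (h.symm.compatible.trans hB)
  obtain ⟨φ, hφ, hl⟩ := h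
  refine IsGluing.labIso (f := fun a => A'.glueInl B (φ a)) (g := A'.glueInr B) ?_
    (fun i => congrArg (A'.glueInl B) (hl i))
  exact
  { injective_fst := hG.injective_fst.comp φ.injective
    injective_snd := hG.injective_snd
    eq_iff := fun a b => by
      rw [hG.eq_iff]
      exact exists_congr fun i => by rw [← hl, φ.injective.eq_iff]
    surj := fun x => by
      obtain ⟨a, rfl⟩ | hb := hG.surj x
      · exact .inl ⟨φ.symm a, congrArg _ (φ.apply_symm_apply a)⟩
      · exact .inr hb
    map_fst := fun haa => hG.map_fst (φ.map_adj_iff.2 haa)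
    map_snd := hG.map_snd
    adj := fun hxy => by
      obtain ⟨a, a', haa, rfl, rfl⟩ | hb := hG.adj hxy
      · exact .inl ⟨φ.symm a, φ.symm a', φ.symm.map_adj_iff.2 haa,
          congrArg _ (φ.apply_symm_apply a), congrArg _ (φ.apply_symm_apply a')⟩
      · exact .inr hb
    color_fst := fun a => (hG.color_fst _).trans (hφ a)
    color_snd := hG.color_snd }

theorem glue_comm {A B : BGraph t} (h : A.Compatible B) : (A.glue B).LabIso (B.glue A) :=
  (isGluing_glue h.symm).symm.labIso fun i => glueInr_of_lab B A i

theorem compatible_glue_right {A B C : BGraph t} :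
    A.Compatible (B.glue C) ↔ A.Compatible B :=
  Iff.rfl

theorem compatible_glue_left {A B C : BGraph t} :
    (A.glue B).Compatible C ↔ A.Compatible C :=
  Iff.rfl

theorem LabIso.glue {A A' B B' : BGraph t} (h : A.LabIso A') (k : B.LabIso B')
    (hAB : A.Compatible B) : (A.glue B).LabIso (A'.glue B') := by
  have h1 : A'.Compatible B := h.symm.compatible.trans hAB
  exact (h.glue_left hAB).trans ((glue_comm h1).trans ((k.glue_left h1.symm).trans
    (glue_comm (k.symm.compatible.trans h1.symm))))

theorem glue_assoc {A B C : BGraph t} (hAB : A.Compatible B) (hBC : B.Compatible C) :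
    ((A.glue B).glue C).LabIso (A.glue (B.glue C)) := by
  have hX := isGluing_glue (compatible_glue_right (C := C).2 hAB)
  have hY := isGluing_glue hBC
  have hZ := isGluing_glue hAB
  let f : (A.glue B).V → (A.glue (B.glue C)).V :=
    Sum.elim (A.glueInl (B.glue C)) fun b => A.glueInr (B.glue C) (B.glueInl C b.1)
  have h1 : ∀ a, f (A.glueInl B a) = A.glueInl (B.glue C) a := fun _ => rfl
  have h2 : ∀ b, f (A.glueInr B b) = A.glueInr (B.glue C) (B.glueInl C b) := by
    intro b
    obtain ⟨i, rfl, hi⟩ | ⟨hb, hi⟩ := glueInr_cases A B b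
    · rw [hi, h1]
      exact hX.fst_lab i
    · rw [hi]
      rfl
  -- Vertices `a` of `A` and `b` of `B` coincide in `A ⊕ (B ⊕ C)` exactly as they do in `A ⊕ B`.
  have h3 : ∀ a b,
      A.glueInl (B.glue C) a = A.glueInr (B.glue C) (B.glueInl C b) ↔ A.SameLabel B a b := by
    intro a b
    rw [hX.eq_iff]
    exact exists_congr fun i => and_congr_right fun _ => Sum.inl_injective.eq_iff
  refine IsGluing.labIso (f := f) (g := fun c => A.glueInr (B.glue C) (B.glueInr C c)) ?_
    (fun i => rfl)
  refine
  { injective_fst := ?_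
    injective_snd := hX.injective_snd.comp hY.injective_snd
    eq_iff := ?_
    surj := ?_
    map_fst := ?_
    map_snd := fun h => hX.map_snd (hY.map_snd h)
    adj := ?_
    color_fst := ?_
    color_snd := fun c => (hX.color_snd _).trans (hY.color_snd c) }
  · intro x y hxy
    obtain ⟨a, rfl⟩ | ⟨a, rfl⟩ := hZ.surj x <;> obtain ⟨b, rfl⟩ | ⟨b, rfl⟩ := hZ.surj y
    · exact congrArg _ (Sum.inl_injective hxy)
    · rw [h1, h2, h3] at hxy
      exact (hZ.eq_iff _ _).2 hxy
    · rw [h1, h2] at hxy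
      exact ((hZ.eq_iff _ _).2 ((h3 _ _).1 hxy.symm)).symm
    · rw [h2, h2] at hxy
      exact congrArg _ (Sum.inl_injective (hX.injective_snd hxy))
  · intro z c
    obtain ⟨a, rfl⟩ | ⟨b, rfl⟩ := hZ.surj z
    · rw [h1, hX.eq_iff]
      constructor
      · rintro ⟨i, rfl, hi⟩
        obtain ⟨j, hj, rfl⟩ := (hY.eq_iff _ _).1 hi
        exact ⟨i, rfl, by rw [B.lab.injective hj]⟩
      · rintro ⟨i, hi, rfl⟩
        exact ⟨i, Sum.inl_injective hi, hY.fst_lab i⟩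
    · rw [h2, hX.injective_snd.eq_iff, hY.eq_iff]
      constructor
      · rintro ⟨i, rfl, rfl⟩
        exact ⟨i, hZ.fst_lab i, rfl⟩
      · rintro ⟨i, hi, rfl⟩
        exact ⟨i, hZ.injective_snd ((hZ.fst_lab i).symm.trans hi), rfl⟩
  · intro x
    obtain ⟨a, rfl⟩ | ⟨y, rfl⟩ := hX.surj x
    · exact .inl ⟨A.glueInl B a, rfl⟩
    · obtain ⟨b, rfl⟩ | ⟨c, rfl⟩ := hY.surj y
      · exact .inl ⟨_, h2 b⟩
      · exact .inr ⟨c, rfl⟩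
  · intro x y hxy
    obtain ⟨a, a', haa, rfl, rfl⟩ | ⟨b, b', hbb, rfl, rfl⟩ := hZ.adj hxy
    · exact hX.map_fst haa
    · rw [h2, h2]
      exact hX.map_snd (hY.map_fst hbb)
  · intro x y hxy
    obtain ⟨a, a', haa, rfl, rfl⟩ | ⟨b, b', hbb, rfl, rfl⟩ := hX.adj hxy
    · exact .inl ⟨_, _, hZ.map_fst haa, rfl, rfl⟩
    · obtain ⟨a, a', haa, rfl, rfl⟩ | ⟨c, c', hcc, rfl, rfl⟩ := hY.adj hbb
      · exact .inl ⟨_, _, hZ.map_snd haa, h2 _, h2 _⟩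
      · exact .inr ⟨_, _, hcc, rfl, rfl⟩
  · intro x
    obtain ⟨a, rfl⟩ | ⟨b, rfl⟩ := hZ.surj x
    · rfl
    · rw [h2, hX.color_snd, hZ.color_snd]
      rfl

theorem glue_discrete (A : BGraph t) :
    (A.glue (discrete fun i => A.color (A.lab i))).LabIso A := by
  refine IsGluing.labIso (f := id) (g := A.lab) ?_ fun _ => rfl
  exact
  { injective_fst := Function.injective_id
    injective_snd := A.lab.injective
    eq_iff := fun a b =>
      ⟨fun h => ⟨b, h.symm, rfl⟩, fun ⟨i, hi, hi'⟩ => by rw [← hi, ← hi']; rfl⟩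
    surj := fun x => .inl ⟨x, rfl⟩
    map_fst := id
    map_snd := fun h => h.elim
    adj := fun h => .inl ⟨_, _, h, rfl, rfl⟩
    color_fst := fun _ => rfl
    color_snd := fun _ => rfl }

theorem addEdge_glue (ht : 2 ≤ t) {A B : BGraph t} (h : A.Compatible B) :
    ((A.addEdge ht).glue B).LabIso (A.glue (B.addEdge ht)) := by
  have hX := isGluing_glue (A := A) (B := B.addEdge ht) h
  refine IsGluing.labIso (A := A.addEdge ht) (B := B) (f := A.glueInl (B.addEdge ht))
    (g := A.glueInr (B.addEdge ht)) ?_ fun _ => rfl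
  refine
  { injective_fst := hX.injective_fst
    injective_snd := hX.injective_snd
    eq_iff := hX.eq_iff
    surj := hX.surj
    map_fst := ?_
    map_snd := fun {b b'} hbb => hX.map_snd ((addEdge_adj ht B b b').2 (.inl hbb))
    adj := ?_
    color_fst := hX.color_fst
    color_snd := hX.color_snd }
  · intro a a' haa
    obtain haa | ⟨rfl, rfl⟩ | ⟨rfl, rfl⟩ := (addEdge_adj ht A a a').1 haa
    · exact hX.map_fst haa
    · have := hX.map_snd ((addEdge_adj ht B _ _).2 (.inr (.inl ⟨rfl, rfl⟩)))
      exact (congrArg₂ _ (hX.fst_lab _) (hX.fst_lab _)).mpr this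
    · have := hX.map_snd ((addEdge_adj ht B _ _).2 (.inr (.inr ⟨rfl, rfl⟩)))
      exact (congrArg₂ _ (hX.fst_lab _) (hX.fst_lab _)).mpr this
  · intro x y hxy
    obtain ⟨a, a', haa, rfl, rfl⟩ | ⟨b, b', hbb, rfl, rfl⟩ := hX.adj hxy
    · exact .inl ⟨a, a', (addEdge_adj ht A a a').2 (.inl haa), rfl, rfl⟩
    · obtain hbb | ⟨rfl, rfl⟩ | ⟨rfl, rfl⟩ := (addEdge_adj ht B b b').1 hbb
      · exact .inr ⟨b, b', hbb, rfl, rfl⟩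
      · exact .inl ⟨_, _, (addEdge_adj ht A _ _).2 (.inr (.inl ⟨rfl, rfl⟩)), hX.fst_lab _,
          hX.fst_lab _⟩
      · exact .inl ⟨_, _, (addEdge_adj ht A _ _).2 (.inr (.inr ⟨rfl, rfl⟩)), hX.fst_lab _,
          hX.fst_lab _⟩

theorem Compatible.relabel {σ : Equiv.Perm (Fin t)} {A B : BGraph t}
    (h : (A.relabel σ).Compatible B) : A.Compatible (B.relabel σ.symm) := fun i => by
  have := h (σ.symm i)
  rwa [relabel_lab, σ.apply_symm_apply] at this

theorem relabel_glue (σ : Equiv.Perm (Fin t)) {A B : BGraph t}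
    (h : (A.relabel σ).Compatible B) :
    ((A.relabel σ).glue B).Iso (A.glue (B.relabel σ.symm)) := by
  have hX := isGluing_glue h.relabel
  refine IsGluing.iso (A := A.relabel σ) (B := B) (f := A.glueInl (B.relabel σ.symm))
    (g := A.glueInr (B.relabel σ.symm)) ?_
  exact
  { injective_fst := hX.injective_fst
    injective_snd := hX.injective_snd
    eq_iff := fun a b => (hX.eq_iff a b).trans
      ⟨fun ⟨i, hi, hi'⟩ => ⟨σ.symm i, by rw [relabel_lab, σ.apply_symm_apply, hi], hi'⟩,
        fun ⟨i, hi, hi'⟩ => ⟨σ i, hi, by rw [relabel_lab, σ.symm_apply_apply, hi']⟩⟩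
    surj := hX.surj
    map_fst := hX.map_fst
    map_snd := hX.map_snd
    adj := hX.adj
    color_fst := hX.color_fst
    color_snd := hX.color_snd }

theorem Compatible.newVertex {ht : 1 ≤ t} {l : Color} {A B : BGraph t}
    (h : (A.newVertex ht l).Compatible B) :
    A.Compatible (B.newVertex ht (A.color (A.lab ⟨0, ht⟩))) := by
  intro i
  by_cases hi : i = ⟨0, ht⟩
  · rw [hi, newVertex_lab_zero]
    rfl
  · have := h i
    rw [newVertex_lab_of_ne _ _ _ hi] at this ⊢
    exact this

/-- The vertex that loses the label 1 on the left plays the part of the vertex that gains it on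
the right, and conversely; the boundaries of the two graphs differ. -/
theorem newVertex_glue (ht : 1 ≤ t) (l : Color) {A B : BGraph t}
    (h : (A.newVertex ht l).Compatible B) :
    ((A.newVertex ht l).glue B).Iso
      (A.glue (B.newVertex ht (A.color (A.lab ⟨0, ht⟩)))) := by
  set c := A.color (A.lab ⟨0, ht⟩)
  have hl : B.color (B.lab ⟨0, ht⟩) = l := by
    have := h ⟨0, ht⟩
    rw [newVertex_lab_zero] at this
    exact this.symm
  have h' : A.Compatible (B.newVertex ht c) := h.newVertex
  have hX := isGluing_glue h'
  let g : B.V → (A.glue (B.newVertex ht c)).V :=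
    fun b => A.glueInr (B.newVertex ht c) (newVertexOld ht c B b)
  have hg : Function.Injective g := hX.injective_snd.comp (newVertexOld_injective ht c B)
  let f : (A.newVertex ht l).V → (A.glue (B.newVertex ht c)).V :=
    fun v => Option.elim v (g (B.lab ⟨0, ht⟩)) (A.glueInl (B.newVertex ht c))
  have f_new : f (newVertexNew ht l A) = g (B.lab ⟨0, ht⟩) := rfl
  have f_old : ∀ a, f (newVertexOld ht l A a) = A.glueInl (B.newVertex ht c) a := fun _ => rfl
  have f_old_eq : ∀ (a : A.V) (b : B.V), f (newVertexOld ht l A a) = g b ↔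
      ∃ i, i ≠ ⟨0, ht⟩ ∧ A.lab i = a ∧ B.lab i = b := by
    intro a b
    rw [f_old, hX.eq_iff]
    refine exists_congr fun i => ?_
    by_cases hi : i = ⟨0, ht⟩
    · rw [hi, newVertex_lab_zero]
      simp [(newVertexOld_ne ht c B b).symm]
    · rw [newVertex_lab_of_ne _ _ _ hi, (newVertexOld_injective ht c B).eq_iff]
      simp [hi]
  have hne : ∀ a : A.V, f (newVertexOld ht l A a) ≠ f (newVertexNew ht l A) := by
    intro a ha
    obtain ⟨i, hi, -, hi'⟩ := (f_old_eq _ _).1 ha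
    exact hi (B.lab.injective hi')
  refine IsGluing.iso (f := f) (g := g) ?_
  refine
  { injective_fst := ?_
    injective_snd := hg
    eq_iff := ?_
    surj := ?_
    map_fst := ?_
    map_snd := fun {b b'} hbb => hX.map_snd ((newVertex_adj ht c B _ _).2 ⟨b, b', hbb, rfl, rfl⟩)
    adj := ?_
    color_fst := ?_
    color_snd := fun b => hX.color_snd (newVertexOld ht c B b) }
  · intro x y hxy
    obtain rfl | ⟨a, rfl⟩ := newVertex_cases ht l A x <;>
      obtain rfl | ⟨b, rfl⟩ := newVertex_cases ht l A y
    · rfl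
    · exact absurd hxy.symm (hne b)
    · exact absurd hxy (hne a)
    · exact congrArg _ (hX.injective_fst hxy)
  · intro x b
    obtain rfl | ⟨a, rfl⟩ := newVertex_cases ht l A x
    · rw [f_new, hg.eq_iff]
      constructor
      · intro hb
        exact ⟨_, newVertex_lab_zero ht l A, hb⟩
      · rintro ⟨i, hi, rfl⟩
        by_cases hi0 : i = ⟨0, ht⟩
        · rw [hi0]
        · rw [newVertex_lab_of_ne _ _ _ hi0] at hi
          exact absurd hi (newVertexOld_ne ht l A _)
    · refine (f_old_eq a b).trans (exists_congr fun i => ?_)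
      by_cases hi : i = ⟨0, ht⟩
      · rw [hi, newVertex_lab_zero]
        simp [(newVertexOld_ne ht l A a).symm]
      · rw [newVertex_lab_of_ne _ _ _ hi, (newVertexOld_injective ht l A).eq_iff]
        simp [hi]
  · intro x
    obtain ⟨a, rfl⟩ | ⟨y, rfl⟩ := hX.surj x
    · exact .inl ⟨_, f_old a⟩
    · obtain rfl | ⟨b, rfl⟩ := newVertex_cases ht c B y
      · refine .inl ⟨newVertexOld ht l A (A.lab ⟨0, ht⟩), ?_⟩
        rw [f_old, ← newVertex_lab_zero ht c B]
        exact hX.fst_lab _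
      · exact .inr ⟨b, rfl⟩
  · intro x y hxy
    obtain ⟨a, a', haa, rfl, rfl⟩ := (newVertex_adj ht l A x y).1 hxy
    exact hX.map_fst haa
  · intro x y hxy
    obtain ⟨a, a', haa, rfl, rfl⟩ | ⟨b, b', hbb, rfl, rfl⟩ := hX.adj hxy
    · exact .inl ⟨_, _, (newVertex_adj ht l A _ _).2 ⟨a, a', haa, rfl, rfl⟩, rfl, rfl⟩
    · obtain ⟨d, d', hdd, rfl, rfl⟩ := (newVertex_adj ht c B b b').1 hbb
      exact .inr ⟨d, d', hdd, rfl, rfl⟩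
  · intro x
    obtain rfl | ⟨a, rfl⟩ := newVertex_cases ht l A x
    · exact (hX.color_snd _).trans hl
    · rfl

end BGraph

/-! ### The small universe -/

section SmallUniverse

variable {t : ℕ}

open BGraph

/-- Induction along a parse tree. -/
theorem value_induction {P : BGraph t → Prop} (empty : ∀ n, P (BGraph.empty n))
    (addEdge : ∀ ht G, P G → P (G.addEdge ht))
    (newVertex : ∀ ht l G, P G → P (G.newVertex ht l))
    (shift : ∀ G, P G → P G.shift) (swap : ∀ ht G, P G → P (G.swap ht))
    (glue : ∀ G H, G.Compatible H → P G → P H → P (G.glue H))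
    (T : LTree (ParseOp t)) (G : BGraph t) (hT : value T = some G) : P G := by
  induction T generalizing G with
  | leaf a =>
    cases a <;> simp only [value, Option.some.injEq, reduceCtorEq] at hT
    exact hT ▸ empty _
  | unary a x ih =>
    cases a <;> simp only [value, Option.map_eq_some_iff, reduceCtorEq] at hT <;>
      obtain ⟨H, hH, rfl⟩ := hT
    · exact addEdge _ _ (ih _ hH)
    · exact newVertex _ _ _ (ih _ hH)
    · exact shift _ (ih _ hH)
    · exact swap _ _ (ih _ hH)
  | binary a x y ihx ihy =>
    cases a <;> simp only [value, Option.bind_eq_some_iff, reduceCtorEq] at hT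
    obtain ⟨H, hH, K, hK, hHK⟩ := hT
    split_ifs at hHK with hc
    obtain rfl := Option.some.inj hHK
    exact glue _ _ hc (ihx _ hH) (ihy _ hK)

theorem value_glue {T T' : LTree (ParseOp t)} {G H : BGraph t} (hT : value T = some G)
    (hT' : value T' = some H) (h : G.Compatible H) :
    value (.binary .glue T T') = some (G.glue H) := by
  simp [value, hT, hT', h]

theorem mem_USmall_of_value {T : LTree (ParseOp t)} {G : BGraph t} (hT : value T = some G) :
    G ∈ USmall t :=
  ⟨T, G, hT, LabIso.refl G⟩

theorem USmall.of_labIso {G H : BGraph t} (hH : H ∈ USmall t) (h : G.LabIso H) :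
    G ∈ USmall t := by
  obtain ⟨T, K, hT, hK⟩ := hH
  exact ⟨T, K, hT, h.trans hK⟩

theorem USmall.empty (n : Fin (t + 1)) : BGraph.empty n ∈ USmall t :=
  ⟨.leaf (.empty n), _, rfl, LabIso.refl _⟩

theorem USmall.addEdge (ht : 2 ≤ t) {G : BGraph t} (hG : G ∈ USmall t) :
    G.addEdge ht ∈ USmall t := by
  obtain ⟨T, K, hT, hK⟩ := hG
  exact ⟨.unary (.edge ht) T, _, by simp [value, hT], hK.addEdge ht⟩

theorem USmall.newVertex (ht : 1 ≤ t) (l : Color) {G : BGraph t} (hG : G ∈ USmall t) :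
    G.newVertex ht l ∈ USmall t := by
  obtain ⟨T, K, hT, hK⟩ := hG
  exact ⟨.unary (.newVertex ht l) T, _, by simp [value, hT], hK.newVertex ht l⟩

theorem USmall.shift {G : BGraph t} (hG : G ∈ USmall t) : G.shift ∈ USmall t := by
  obtain ⟨T, K, hT, hK⟩ := hG
  exact ⟨.unary .shift T, K.shift, by simp [value, hT], hK.relabel _⟩

theorem USmall.swap (ht : 2 ≤ t) {G : BGraph t} (hG : G ∈ USmall t) : G.swap ht ∈ USmall t := by
  obtain ⟨T, K, hT, hK⟩ := hG
  exact ⟨.unary (.swap ht) T, K.swap ht, by simp [value, hT], hK.relabel _⟩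

theorem USmall.glue {G H : BGraph t} (hG : G ∈ USmall t) (hH : H ∈ USmall t)
    (h : G.Compatible H) : G.glue H ∈ USmall t := by
  obtain ⟨T, K, hT, hK⟩ := hG
  obtain ⟨T', K', hT', hK'⟩ := hH
  exact ⟨_, _, value_glue hT hT' ((hK.symm.compatible.trans h).trans hK'.compatible),
    hK.glue hK' h⟩

/-- The operators `shift` and `swap` generate all permutations of the labels. -/
theorem USmall.relabel (σ : Equiv.Perm (Fin t)) {G : BGraph t} (hG : G ∈ USmall t) :
    G.relabel σ ∈ USmall t := by
  let S : Submonoid (Equiv.Perm (Fin t)) :=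
    { carrier := {σ | ∀ G ∈ USmall t, G.relabel σ ∈ USmall t}
      one_mem' := fun G hG => hG
      mul_mem' := fun {σ τ} hσ hτ G hG => hτ _ (hσ G hG) }
  suffices h : σ ∈ S from h G hG
  by_cases ht : 2 ≤ t
  · obtain ⟨n, rfl⟩ : ∃ n, t = n + 2 := ⟨t - 2, by omega⟩
    have hgen := Equiv.Perm.closure_cycle_adjacent_swap (σ := finRotate (n + 2)) isCycle_finRotate
      support_finRotate 0
    have hσ : σ ∈ Subgroup.closure {finRotate (n + 2), Equiv.swap 0 (finRotate (n + 2) 0)} := by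
      rw [hgen]
      trivial
    rw [← Subgroup.mem_toSubmonoid, Subgroup.closure_toSubmonoid_of_finite] at hσ
    refine Submonoid.closure_le.2 ?_ hσ
    rintro τ (rfl | rfl)
    · exact fun G hG => USmall.shift hG
    · intro G hG
      have h1 : finRotate (n + 2) 0 = ⟨1, by omega⟩ := by simp
      rw [h1]
      exact USmall.swap ht hG
  · have : Subsingleton (Fin t) := Fin.subsingleton_iff_le_one.2 (by omega)
    rw [Subsingleton.elim σ 1]
    exact S.one_mem

theorem USmall.discrete (c : Fin t → Color) : BGraph.discrete c ∈ USmall t := by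
  classical
  let n : Fin (t + 1) := ⟨Fintype.card {i // c i = Color.one}, by
    simpa [Nat.lt_succ_iff] using Fintype.card_subtype_le fun i => c i = Color.one⟩
  have hcard : Fintype.card {i // c i = Color.one} = Fintype.card {i : Fin t // (i : ℕ) < n} := by
    have h : Fintype.card {i : Fin t // (i : ℕ) < n} = n :=
      Fintype.card_fin_lt_of_le (Nat.lt_succ_iff.1 n.2)
    rw [h]
  let e₀ := Fintype.equivOfCardEq hcard
  let e := e₀.extendSubtype
  have he : ∀ i, (e i : ℕ) < n ↔ c i = Color.one := fun i =>
    ⟨fun h => by_contra fun h' => e₀.extendSubtype_not_mem i h' h,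
      e₀.extendSubtype_mem i⟩
  refine USmall.of_labIso (USmall.relabel e (USmall.empty n)) ⟨⟨e, Iff.rfl⟩, ?_, fun _ => rfl⟩
  intro (v : Fin t)
  change (if (e v : ℕ) < n then Color.one else Color.two) = c v
  simp only [he]
  split_ifs with h
  · exact h.symm
  · cases hv : c v
    · exact absurd hv h
    · rfl

/-- The subgraph of `K` formed by the vertices in `S`, which contains the boundary, and the edges
in `Γ`. -/
def BGraph.sub (K : BGraph t) (S : Set K.V) (Γ : SimpleGraph K.V) (hS : ∀ i, K.lab i ∈ S) :
    BGraph t where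
  V := S
  finite_V := by
    have := K.finite_V
    infer_instance
  graph := Γ.comap Subtype.val
  color v := K.color v
  lab := ⟨fun i => ⟨K.lab i, hS i⟩, fun i j h => K.lab.injective (congrArg Subtype.val h)⟩

/-- A boundaried graph that maps injectively, with respect to edges and labels, into a generated
one is itself generated. Colors may differ, as the operators build vertices of either color alike.
The map is followed down the parse tree: an operator is replayed on the subgraph if it created
something that is used there. -/
theorem USmall.of_injective_hom {X : BGraph t} (hX : X ∈ USmall t) {K : BGraph t}
    (φ : K.V → X.V) (hφ : Function.Injective φ)
    (hadj : ∀ v w, K.graph.Adj v w → X.graph.Adj (φ v) (φ w))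
    (hlab : ∀ i, φ (K.lab i) = X.lab i) : K ∈ USmall t := by
  obtain ⟨T, Y, hT, e, -, he⟩ := hX
  suffices h : ∀ (K : BGraph t) (φ : K.V → Y.V), Function.Injective φ →
      (∀ v w, K.graph.Adj v w → Y.graph.Adj (φ v) (φ w)) → (∀ i, φ (K.lab i) = Y.lab i) →
      K ∈ USmall t from
    h K (fun v => e (φ v)) (e.injective.comp hφ) (fun v w h => e.map_adj_iff.2 (hadj v w h))
      fun i => by rw [hlab, he]
  clear hadj hlab hφ φ he e K X
  refine value_induction (P := fun Y => ∀ (K : BGraph t) (φ : K.V → Y.V), Function.Injective φ →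
      (∀ v w, K.graph.Adj v w → Y.graph.Adj (φ v) (φ w)) → (∀ i, φ (K.lab i) = Y.lab i) →
      K ∈ USmall t) ?_ ?_ ?_ ?_ ?_ ?_ T Y hT
  · intro n K φ hφ hadj hlab
    refine USmall.of_labIso (USmall.discrete fun i => K.color (K.lab i)) (LabIso.symm ?_)
    -- All vertices of `empty n` lie on the boundary, hence so do those of `K`.
    have hsurj : Function.Surjective K.lab := fun v => ⟨φ v, hφ (hlab (φ v))⟩
    refine ⟨⟨Equiv.ofBijective K.lab ⟨K.lab.injective, hsurj⟩, ?_⟩, fun _ => rfl, fun _ => rfl⟩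
    intro a b
    exact ⟨fun h => (hadj _ _ h).elim, fun h => h.elim⟩
  · intro ht G ih K φ hφ hadj hlab
    -- The graph `K` without the edge that the operator may have created.
    let K' : BGraph t :=
      { K with graph := K.graph.deleteEdges {s(K.lab ⟨0, by omega⟩, K.lab ⟨1, by omega⟩)} }
    have hK' : K' ∈ USmall t := by
      refine ih K' φ hφ ?_ hlab
      intro v w hvw
      have hvw' := (SimpleGraph.deleteEdges_adj.1 hvw)
      obtain h | ⟨h, h'⟩ | ⟨h, h'⟩ := (addEdge_adj ht G _ _).1 (hadj v w hvw'.1)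
      · exact h
      · obtain rfl := hφ (h.trans (hlab _).symm)
        obtain rfl := hφ (h'.trans (hlab _).symm)
        exact absurd rfl hvw'.2
      · obtain rfl := hφ (h.trans (hlab _).symm)
        obtain rfl := hφ (h'.trans (hlab _).symm)
        exact absurd Sym2.eq_swap hvw'.2
    have hK'_adj : ∀ v w, K'.graph.Adj v w ↔
        K.graph.Adj v w ∧ s(v, w) ≠ s(K.lab ⟨0, by omega⟩, K.lab ⟨1, by omega⟩) :=
      fun v w => SimpleGraph.deleteEdges_adj
    by_cases h01 : K.graph.Adj (K.lab ⟨0, by omega⟩) (K.lab ⟨1, by omega⟩)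
    · refine USmall.of_labIso (USmall.addEdge ht hK') ⟨⟨Equiv.refl _, ?_⟩, fun _ => rfl, fun _ => rfl⟩
      intro v w
      refine (addEdge_adj ht K' v w).trans ?_
      rw [hK'_adj]
      constructor
      · rintro (h | ⟨rfl, rfl⟩ | ⟨rfl, rfl⟩)
        · exact h.1
        · exact h01
        · exact h01.symm
      · intro h
        by_cases hvw : s(v, w) = s(K.lab ⟨0, by omega⟩, K.lab ⟨1, by omega⟩)
        · exact .inr (Sym2.eq_iff.1 hvw)
        · exact .inl ⟨h, hvw⟩
    · refine USmall.of_labIso hK' ⟨⟨Equiv.refl _, ?_⟩, fun _ => rfl, fun _ => rfl⟩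
      intro v w
      refine (hK'_adj v w).trans ⟨And.left, fun h => ⟨h, fun hvw => ?_⟩⟩
      obtain ⟨rfl, rfl⟩ | ⟨rfl, rfl⟩ := Sym2.eq_iff.1 hvw
      · exact h01 h
      · exact h01 h.symm
  · intro ht l G ih K φ hφ hadj hlab
    let k := K.lab ⟨0, ht⟩
    have hk : φ k = newVertexNew ht l G := (hlab _).trans (newVertex_lab_zero ht l G)
    let ψ : K.V → G.V := fun v => Option.elim (φ v) (G.lab ⟨0, ht⟩) id
    have ψ_eq : ∀ {v a}, newVertexOld ht l G a = φ v → ψ v = a := by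
      intro v a h
      change Option.elim (φ v) _ _ = a
      rw [← h]
      rfl
    have hψk : ψ k = G.lab ⟨0, ht⟩ := by
      change Option.elim (φ k) _ _ = _
      rw [hk]
      rfl
    have hψ : ∀ v, v ≠ k → φ v = newVertexOld ht l G (ψ v) := by
      intro v hv
      obtain h | ⟨a, h⟩ := newVertex_cases ht l G (φ v)
      · exact absurd (hφ (h.trans hk.symm)) hv
      · rw [ψ_eq h.symm, h]
    have hψ_inj : ∀ v w, v ≠ k → w ≠ k → ψ v = ψ w → v = w := fun v w hv hw h =>
      hφ (by rw [hψ v hv, hψ w hw, h])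
    have hψ_adj : ∀ v w, K.graph.Adj v w → G.graph.Adj (ψ v) (ψ w) := by
      intro v w h
      obtain ⟨a, b, hab, ha, hb⟩ := (newVertex_adj ht l G _ _).1 (hadj v w h)
      rwa [ψ_eq ha, ψ_eq hb]
    have hψ_lab : ∀ i, ψ (K.lab i) = G.lab i := by
      intro i
      by_cases hi : i = ⟨0, ht⟩
      · rw [hi]
        exact hψk
      · exact ψ_eq ((newVertex_lab_of_ne ht l G hi).symm.trans (hlab i).symm)
    have hk_adj : ∀ w, ¬ K.graph.Adj k w := by
      intro w h
      obtain ⟨a, b, -, ha, -⟩ := (newVertex_adj ht l G _ _).1 (hadj k w h)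
      exact newVertexOld_ne ht l G a (ha.trans hk)
    by_cases hex : ∃ v, v ≠ k ∧ ψ v = G.lab ⟨0, ht⟩
    · -- The vertex that loses the label 1 belongs to `K`, so `K` arises by `newVertex` as well.
      obtain ⟨v₀, hv₀, hψv₀⟩ := hex
      have hlab_ne : ∀ i, i ≠ ⟨0, ht⟩ → K.lab i ≠ k := fun i hi h => hi (K.lab.injective h)
      let lab' : Fin t → {v : K.V // v ≠ k} :=
        fun i => if hi : i = ⟨0, ht⟩ then ⟨v₀, hv₀⟩ else ⟨K.lab i, hlab_ne i hi⟩
      have lab'_zero : lab' ⟨0, ht⟩ = ⟨v₀, hv₀⟩ := dif_pos rfl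
      have lab'_ne : ∀ i (hi : i ≠ ⟨0, ht⟩), lab' i = ⟨K.lab i, hlab_ne i hi⟩ :=
        fun i hi => dif_neg hi
      have hψ_lab' : ∀ i, ψ (lab' i).1 = G.lab i := by
        intro i
        by_cases hi : i = ⟨0, ht⟩
        · rw [hi, lab'_zero]
          exact hψv₀
        · rw [lab'_ne i hi]
          exact hψ_lab i
      let K' : BGraph t :=
        { V := {v : K.V // v ≠ k}
          finite_V := by
            have := K.finite_V
            infer_instance
          graph := K.graph.comap Subtype.val
          color := fun v => K.color v
          lab := ⟨lab', fun i j hij => G.lab.injective (by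
            rw [← hψ_lab', ← hψ_lab', hij])⟩ }
      have hK' : K' ∈ USmall t := ih K' (fun v => ψ v.1)
        (fun v w h => Subtype.ext (hψ_inj v.1 w.1 v.2 w.2 h)) (fun v w h => hψ_adj _ _ h) hψ_lab'
      classical
      refine USmall.of_labIso (USmall.newVertex ht (K.color k) hK') (LabIso.symm
        ⟨⟨Equiv.optionSubtypeNe k, ?_⟩, ?_, ?_⟩)
      · rintro (_ | v) (_ | w)
        · exact ⟨fun h => (h.ne rfl).elim, fun h => (h.ne rfl).elim⟩
        · refine ⟨fun h => (hk_adj _ h).elim, fun h => ?_⟩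
          obtain ⟨a, b, -, ha, -⟩ := (newVertex_adj ht (K.color k) K' _ _).1 h
          exact (newVertexOld_ne _ _ _ _ ha).elim
        · refine ⟨fun h => (hk_adj _ h.symm).elim, fun h => ?_⟩
          obtain ⟨a, b, -, -, hb⟩ := (newVertex_adj ht (K.color k) K' _ _).1 h
          exact (newVertexOld_ne _ _ _ _ hb).elim
        · refine Iff.trans ?_ (newVertex_adj ht (K.color k) K' _ _).symm
          constructor
          · exact fun h => ⟨v, w, h, rfl, rfl⟩
          · rintro ⟨a, b, hab, ha, hb⟩
            obtain rfl := newVertexOld_injective _ _ _ ha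
            obtain rfl := newVertexOld_injective _ _ _ hb
            exact hab
      · rintro (_ | v) <;> rfl
      · intro i
        by_cases hi : i = ⟨0, ht⟩
        · rw [hi, newVertex_lab_zero]
          rfl
        · rw [newVertex_lab_of_ne _ _ _ hi]
          exact congrArg Subtype.val (lab'_ne i hi)
    · -- Otherwise the new vertex, isolated in `K`, can take the place of that vertex.
      refine ih K ψ ?_ hψ_adj hψ_lab
      intro v w h
      by_cases hv : v = k <;> by_cases hw : w = k
      · rw [hv, hw]
      · exact absurd ⟨w, hw, by rw [← h, hv, hψk]⟩ hex
      · exact absurd ⟨v, hv, by rw [h, hw, hψk]⟩ hex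
      · exact hψ_inj v w hv hw h
  · intro G ih K φ hφ hadj hlab
    have h := ih (K.relabel (finRotate t).symm) φ hφ hadj fun i => by
      rw [relabel_lab]
      refine (hlab _).trans (congrArg G.lab ((finRotate t).apply_symm_apply i))
    exact USmall.of_labIso (USmall.relabel (finRotate t) h) ⟨SimpleGraph.Iso.refl, fun _ => rfl, fun i =>
      congrArg K.lab ((finRotate t).symm_apply_apply i).symm⟩
  · intro ht G ih K φ hφ hadj hlab
    have h := ih (K.swap ht) φ hφ hadj fun i =>
      (hlab _).trans (congrArg G.lab (Equiv.swap_apply_self _ _ i))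
    exact USmall.of_labIso (USmall.swap ht h) ⟨SimpleGraph.Iso.refl, fun _ => rfl, fun i =>
      congrArg K.lab (Equiv.swap_apply_self _ _ i).symm⟩
  · intro G H hGH ihG ihH K φ hφ hadj hlab
    have hX := isGluing_glue hGH
    let Γ₁ := (G.graph.map (G.glueInl H)).comap φ
    let Γ₂ := (H.graph.map (G.glueInr H)).comap φ
    have hΓ₁ : ∀ v w, Γ₁.Adj v w ↔
        ∃ a a', G.graph.Adj a a' ∧ G.glueInl H a = φ v ∧ G.glueInl H a' = φ w :=
      fun v w => SimpleGraph.map_adj ⟨G.glueInl H, hX.injective_fst⟩ _ _ _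
    have hΓ₂ : ∀ v w, Γ₂.Adj v w ↔
        ∃ a a', H.graph.Adj a a' ∧ G.glueInr H a = φ v ∧ G.glueInr H a' = φ w :=
      fun v w => SimpleGraph.map_adj ⟨G.glueInr H, hX.injective_snd⟩ _ _ _
    have hlab₁ : ∀ i, G.glueInl H (G.lab i) = φ (K.lab i) := fun i => (hlab i).symm
    have hlab₂ : ∀ i, G.glueInr H (H.lab i) = φ (K.lab i) :=
      fun i => (hX.fst_lab i).symm.trans (hlab i).symm
    let K₁ := K.sub {v | ∃ a, G.glueInl H a = φ v} (K.graph ⊓ Γ₁) fun i => ⟨_, hlab₁ i⟩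
    let K₂ := K.sub {v | ∃ b, G.glueInr H b = φ v} (K.graph ⊓ Γ₂) fun i => ⟨_, hlab₂ i⟩
    have hK₁ : K₁ ∈ USmall t := by
      choose ψ hψ using fun v : K₁.V => v.2
      refine ihG K₁ ψ ?_ ?_ ?_
      · intro v w h
        exact Subtype.ext (hφ (by rw [← hψ, ← hψ, h]))
      · intro v w h
        obtain ⟨a, a', haa, ha, ha'⟩ := (hΓ₁ _ _).1 h.2
        rwa [hX.injective_fst ((hψ v).trans ha.symm), hX.injective_fst ((hψ w).trans ha'.symm)]
      · intro i
        exact hX.injective_fst ((hψ _).trans (hlab₁ i).symm)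
    have hK₂ : K₂ ∈ USmall t := by
      choose ψ hψ using fun v : K₂.V => v.2
      refine ihH K₂ ψ ?_ ?_ ?_
      · intro v w h
        exact Subtype.ext (hφ (by rw [← hψ, ← hψ, h]))
      · intro v w h
        obtain ⟨a, a', haa, ha, ha'⟩ := (hΓ₂ _ _).1 h.2
        rwa [hX.injective_snd ((hψ v).trans ha.symm), hX.injective_snd ((hψ w).trans ha'.symm)]
      · intro i
        exact hX.injective_snd ((hψ _).trans (hlab₂ i).symm)
    have hK : IsGluing K₁ K₂ K Subtype.val Subtype.val :=
      { injective_fst := Subtype.val_injective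
        injective_snd := Subtype.val_injective
        eq_iff := by
          rintro ⟨v, a, ha⟩ ⟨w, b, hb⟩
          constructor
          · rintro rfl
            obtain ⟨i, rfl, rfl⟩ := (hX.eq_iff _ _).1 (ha.trans hb.symm)
            have := hφ (ha.symm.trans (hlab₁ i))
            exact ⟨i, Subtype.ext this.symm, Subtype.ext this.symm⟩
          · rintro ⟨i, hi, hi'⟩
            exact (congrArg Subtype.val hi).symm.trans (congrArg Subtype.val hi')
        surj := fun v => by
          obtain ha | hb := hX.surj (φ v)
          · exact .inl ⟨⟨v, ha⟩, rfl⟩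
          · exact .inr ⟨⟨v, hb⟩, rfl⟩
        map_fst := fun h => h.1
        map_snd := fun h => h.1
        adj := fun {v w} hvw => by
          obtain ⟨a, a', haa, ha, ha'⟩ | ⟨b, b', hbb, hb, hb'⟩ := hX.adj (hadj v w hvw)
          · exact .inl ⟨⟨v, a, ha⟩, ⟨w, a', ha'⟩, ⟨hvw, (hΓ₁ v w).2 ⟨a, a', haa, ha, ha'⟩⟩,
              rfl, rfl⟩
          · exact .inr ⟨⟨v, b, hb⟩, ⟨w, b', hb'⟩, ⟨hvw, (hΓ₂ v w).2 ⟨b, b', hbb, hb, hb'⟩⟩,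
              rfl, rfl⟩
        color_fst := fun _ => rfl
        color_snd := fun _ => rfl }
    exact USmall.of_labIso (USmall.glue hK₁ hK₂ hK.compatible) (hK.labIso fun _ => rfl).symm

/-- A factor of a generated graph is generated. Hence only generated graphs matter as contexts
in the congruence of a set of generated graphs. -/
theorem USmall.of_glue {G H : BGraph t} (h : G.Compatible H) (hGH : G.glue H ∈ USmall t) :
    H ∈ USmall t :=
  USmall.of_injective_hom hGH (G.glueInr H) (isGluing_glue h).injective_snd
    (fun _ _ => (isGluing_glue h).map_snd) fun i => glueInr_of_lab G H i

end SmallUniverse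

/-! ### Finite index and recognizability -/

instance : Finite Color :=
  Finite.of_injective (fun c => decide (c = Color.one)) fun c d h => by
    cases c <;> cases d <;> simp_all

theorem FiniteIndexOver.of_map {X Y : Type*} [Finite Y] {s : Setoid X} {S : Set X} (f : S → Y)
    (hf : ∀ a b, f a = f b → s a.1 b.1) : FiniteIndexOver s S := by
  refine Finite.of_injective (fun q : Quotient (s.comap (Subtype.val : S → X)) => f q.out) ?_
  intro p q hpq
  rw [← p.out_eq, ← q.out_eq]
  exact Quotient.sound (hf _ _ hpq)

/-- A tree language is recognizable if membership depends only on an invariant with finitely many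
values such that the invariant of a tree is determined by those of its children. -/
theorem recognizable_of_invariant {α : Type} [Finite α] {X : Type*} [Finite X] {L : Set (LTree α)}
    (f : LTree α → X) (hunary : ∀ a x x', f x = f x' → f (.unary a x) = f (.unary a x'))
    (hbinary : ∀ a x x' y y', f x = f x' → f y = f y' → f (.binary a x y) = f (.binary a x' y'))
    (hL : ∀ x x', f x = f x' → x ∈ L → x' ∈ L) : Recognizable L := by
  let s := Setoid.ker f
  have : Finite (Quotient s) := Finite.of_equiv _ (Setoid.quotientKerEquivRange f).symm
  let A : TreeAutomaton α :=
    { Q := Option (Quotient s)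
      finite_Q := inferInstance
      δ₁ := fun a q => match q with
        | none => some ⟦.leaf a⟧
        | some q => some (Quotient.map (LTree.unary a) (fun x x' h => hunary a x x' h) q)
      δ₂ := fun a p q => match p, q with
        | some p, some q => some (Quotient.map₂ (LTree.binary a)
            (fun x x' h y y' h' => hbinary a x x' y y' h h') p q)
        | _, _ => none
      q₀ := none
      final := {q | ∃ x ∈ L, q = some ⟦x⟧} }
  have hA : ∀ x, A.state x = some ⟦x⟧ := by
    intro x
    induction x with
    | leaf a => rfl
    | unary a x ih => rw [TreeAutomaton.state, ih]; rfl
    | binary a x y ihx ihy => rw [TreeAutomaton.state, ihx, ihy]; rfl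
  refine ⟨A, fun x => ?_⟩
  rw [TreeAutomaton.Accepts, hA]
  constructor
  · rintro ⟨y, hy, hxy⟩
    exact hL y x (Quotient.exact (Option.some_injective _ hxy)).symm hy
  · exact fun hx => ⟨x, hx, rfl⟩

/-! ### The congruence of a graph problem -/

section GraphCongruence

variable {t : ℕ} {F : Set (BGraph t)}

open BGraph

/-- The set `F` is closed within the small universe under isomorphisms that ignore the labels. -/
def IsoClosed (F : Set (BGraph t)) : Prop :=
  ∀ G ∈ F, ∀ K ∈ USmall t, G.Iso K → K ∈ F

theorem IsoClosed.mem_iff (h : IsoClosed F) {G K : BGraph t} (hG : G ∈ USmall t)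
    (hK : K ∈ USmall t) (hGK : G.Iso K) : G ∈ F ↔ K ∈ F :=
  ⟨fun hGF => h G hGF K hK hGK, fun hKF => h K hKF G hG hGK.symm⟩

theorem IsoClosed.mem_iff_of_labIso (h : IsoClosed F) (hF : F ⊆ USmall t) {G K : BGraph t}
    (hGK : G.LabIso K) : G ∈ F ↔ K ∈ F :=
  ⟨fun hG => h G hG K (USmall.of_labIso (hF hG) hGK.symm) hGK.iso,
    fun hK => h K hK G (USmall.of_labIso (hF hK) hGK) hGK.symm.iso⟩

theorem graphCongruence_of_labIso (hiso : IsoClosed F) (hF : F ⊆ USmall t) {G K : BGraph t}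
    (h : G.LabIso K) : graphCongruence F G K :=
  ⟨h.compatible, fun _ hH _ => hiso.mem_iff_of_labIso hF (h.glue_left hH)⟩

/-- Congruence is tested by generated contexts only. If each context of `K₁` and `K₂` can be
traded for a common context of `G₁` and `G₂`, it passes from `G₁` and `G₂` to `K₁` and `K₂`. -/
theorem graphCongruence_of_context (hiso : IsoClosed F) (hF : F ⊆ USmall t)
    {G₁ G₂ K₁ K₂ : BGraph t} (h : graphCongruence F G₁ G₂)
    (hG₁ : G₁ ∈ USmall t) (hG₂ : G₂ ∈ USmall t) (hK₁ : K₁ ∈ USmall t) (hK₂ : K₂ ∈ USmall t)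
    (hK : K₁.Compatible K₂)
    (hctx : ∀ H ∈ USmall t, K₁.Compatible H → K₂.Compatible H → ∃ H' ∈ USmall t,
      G₁.Compatible H' ∧ (K₁.glue H).Iso (G₁.glue H') ∧ (K₂.glue H).Iso (G₂.glue H')) :
    graphCongruence F K₁ K₂ := by
  refine ⟨hK, fun H h₁ h₂ => ?_⟩
  by_cases hH : H ∈ USmall t
  · obtain ⟨H', hH', hc, i₁, i₂⟩ := hctx H hH h₁ h₂
    have hc' : G₂.Compatible H' := h.1.symm.trans hc
    rw [hiso.mem_iff (USmall.glue hK₁ hH h₁) (USmall.glue hG₁ hH' hc) i₁,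
      hiso.mem_iff (USmall.glue hK₂ hH h₂) (USmall.glue hG₂ hH' hc') i₂]
    exact h.2 H' hc hc'
  · exact ⟨fun hm => (hH (USmall.of_glue h₁ (hF hm))).elim,
      fun hm => (hH (USmall.of_glue h₂ (hF hm))).elim⟩

theorem graphCongruence_addEdge (hiso : IsoClosed F) (hF : F ⊆ USmall t) (ht : 2 ≤ t)
    {G₁ G₂ : BGraph t} (hG₁ : G₁ ∈ USmall t) (hG₂ : G₂ ∈ USmall t)
    (h : graphCongruence F G₁ G₂) : graphCongruence F (G₁.addEdge ht) (G₂.addEdge ht) :=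
  graphCongruence_of_context hiso hF h hG₁ hG₂ (USmall.addEdge ht hG₁) (USmall.addEdge ht hG₂)
    h.1 fun H hH h₁ h₂ => ⟨H.addEdge ht, USmall.addEdge ht hH, h₁,
      (addEdge_glue (A := G₁) ht h₁).iso, (addEdge_glue (A := G₂) ht h₂).iso⟩

theorem graphCongruence_relabel (hiso : IsoClosed F) (hF : F ⊆ USmall t)
    (σ : Equiv.Perm (Fin t)) {G₁ G₂ : BGraph t} (hG₁ : G₁ ∈ USmall t) (hG₂ : G₂ ∈ USmall t)
    (h : graphCongruence F G₁ G₂) : graphCongruence F (G₁.relabel σ) (G₂.relabel σ) :=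
  graphCongruence_of_context hiso hF h hG₁ hG₂ (USmall.relabel σ hG₁) (USmall.relabel σ hG₂)
    (fun i => h.1 (σ i)) fun H hH h₁ h₂ => ⟨H.relabel σ.symm, USmall.relabel _ hH, h₁.relabel,
      relabel_glue σ h₁, relabel_glue σ h₂⟩

theorem graphCongruence_newVertex (hiso : IsoClosed F) (hF : F ⊆ USmall t) (ht : 1 ≤ t)
    (l : Color) {G₁ G₂ : BGraph t} (hG₁ : G₁ ∈ USmall t) (hG₂ : G₂ ∈ USmall t)
    (h : graphCongruence F G₁ G₂) :
    graphCongruence F (G₁.newVertex ht l) (G₂.newVertex ht l) := by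
  refine graphCongruence_of_context hiso hF h hG₁ hG₂ (USmall.newVertex ht l hG₁)
    (USmall.newVertex ht l hG₂) ?_ ?_
  · intro i
    by_cases hi : i = ⟨0, ht⟩
    · rw [hi, newVertex_lab_zero, newVertex_lab_zero]
      rfl
    · rw [newVertex_lab_of_ne _ _ _ hi, newVertex_lab_of_ne _ _ _ hi]
      exact h.1 i
  · intro H hH h₁ h₂
    refine ⟨_, USmall.newVertex ht _ hH, h₁.newVertex, newVertex_glue ht l h₁, ?_⟩
    rw [h.1 ⟨0, ht⟩]
    exact newVertex_glue ht l h₂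

theorem graphCongruence_glue_right (hiso : IsoClosed F) (hF : F ⊆ USmall t)
    {G₁ G₂ K : BGraph t} (hG₁ : G₁ ∈ USmall t) (hG₂ : G₂ ∈ USmall t) (hK : K ∈ USmall t)
    (hc : G₁.Compatible K) (h : graphCongruence F G₁ G₂) :
    graphCongruence F (G₁.glue K) (G₂.glue K) := by
  have hc' : G₂.Compatible K := h.1.symm.trans hc
  refine graphCongruence_of_context hiso hF h hG₁ hG₂ (USmall.glue hG₁ hK hc)
    (USmall.glue hG₂ hK hc') h.1 fun H hH h₁ _ => ?_
  have hKH : K.Compatible H := hc.symm.trans (compatible_glue_left.1 h₁)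
  exact ⟨K.glue H, USmall.glue hK hH hKH, compatible_glue_right.2 hc,
    (glue_assoc hc hKH).iso, (glue_assoc hc' hKH).iso⟩

theorem graphCongruence_glue (hiso : IsoClosed F) (hF : F ⊆ USmall t)
    {G₁ G₂ K₁ K₂ : BGraph t} (hG₁ : G₁ ∈ USmall t) (hG₂ : G₂ ∈ USmall t)
    (hK₁ : K₁ ∈ USmall t) (hK₂ : K₂ ∈ USmall t) (hc : G₁.Compatible K₁)
    (h : graphCongruence F G₁ G₂) (k : graphCongruence F K₁ K₂) :
    graphCongruence F (G₁.glue K₁) (G₂.glue K₂) := by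
  have hc' : G₂.Compatible K₁ := h.1.symm.trans hc
  have h1 := graphCongruence_glue_right hiso hF hG₁ hG₂ hK₁ hc h
  have h2 := graphCongruence_glue_right hiso hF hK₁ hK₂ hG₂ hc'.symm k
  have h3 := graphCongruence_of_labIso hiso hF (glue_comm hc')
  have h4 := graphCongruence_of_labIso hiso hF (glue_comm (k.1.symm.trans hc'.symm))
  exact (graphCongruence F).trans h1 ((graphCongruence F).trans h3
    ((graphCongruence F).trans h2 h4))

/-- Membership in `F` is tested by the context of isolated boundary vertices. -/
theorem graphCongruence_mem (hiso : IsoClosed F) (hF : F ⊆ USmall t) {G K : BGraph t}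
    (h : graphCongruence F G K) (hG : G ∈ F) : K ∈ F := by
  have h1 := (hiso.mem_iff_of_labIso hF (glue_discrete G)).2 hG
  have h2 := (h.2 (discrete fun i => G.color (G.lab i)) (fun _ => rfl) fun i => (h.1 i).symm).1 h1
  have h3 : (fun i => G.color (G.lab i)) = fun i => K.color (K.lab i) := funext h.1
  rw [h3] at h2
  exact (hiso.mem_iff_of_labIso hF (glue_discrete K)).1 h2

/-- The class of the value of a parse tree, and `none` for a tree without a value. -/
noncomputable def valueClass (F : Set (BGraph t)) (T : LTree (ParseOp t)) :
    Option (Quotient ((graphCongruence F).comap (Subtype.val : USmall t → BGraph t))) :=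
  (value T).pmap (fun G hG => Quotient.mk _ ⟨G, hG⟩) fun _ hG => mem_USmall_of_value hG

theorem valueClass_of_none {T : LTree (ParseOp t)} (hT : value T = none) :
    valueClass F T = none :=
  Option.pmap_eq_none_iff.2 hT

theorem valueClass_of_some {T : LTree (ParseOp t)} {G : BGraph t} (hT : value T = some G) :
    valueClass F T = some (Quotient.mk _ ⟨G, mem_USmall_of_value hT⟩) :=
  Option.pmap_eq_some_iff.2 ⟨G, mem_USmall_of_value hT, hT, rfl⟩

theorem valueClass_eq_iff {T T' : LTree (ParseOp t)} :
    valueClass F T = valueClass F T' ↔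
      Option.Rel (graphCongruence F) (value T) (value T') := by
  rcases hT : value T with _ | G <;> rcases hT' : value T' with _ | G'
  · simp [valueClass_of_none hT, valueClass_of_none hT']
  · simp [valueClass_of_none hT, valueClass_of_some hT']
  · simp [valueClass_of_some hT, valueClass_of_none hT']
  · rw [valueClass_of_some hT, valueClass_of_some hT', Option.rel_some_some, Option.some.injEq]
    exact Quotient.eq

theorem recognizable_of_finiteIndexOver (hiso : IsoClosed F) (hF : F ⊆ USmall t)
    (h : FiniteIndexOver (graphCongruence F) (USmall t)) : Recognizable (parseTrees F) := by
  have : Finite _ := h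
  have map_rel : ∀ (op : BGraph t → BGraph t) (T T' : LTree (ParseOp t)),
      Option.Rel (graphCongruence F) (value T) (value T') →
      (∀ G₁ ∈ USmall t, ∀ G₂ ∈ USmall t, graphCongruence F G₁ G₂ →
        graphCongruence F (op G₁) (op G₂)) →
      Option.Rel (graphCongruence F) ((value T).map op) ((value T').map op) := by
    intro op T T' hTT hop
    rcases hT : value T with _ | G <;> rcases hT' : value T' with _ | G' <;>
      rw [hT, hT'] at hTT
    · exact .none
    · cases hTT
    · cases hTT
    · cases hTT with
      | some hGG =>
        exact .some (hop G (mem_USmall_of_value hT) G' (mem_USmall_of_value hT') hGG)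
  refine recognizable_of_invariant (valueClass F) ?_ ?_ ?_
  · intro a T T' hTT
    rw [valueClass_eq_iff] at hTT ⊢
    cases a with
    | empty n => exact .none
    | edge ht =>
      exact map_rel _ T T' hTT fun G₁ h₁ G₂ h₂ h => graphCongruence_addEdge hiso hF ht h₁ h₂ h
    | newVertex ht l =>
      exact map_rel _ T T' hTT fun G₁ h₁ G₂ h₂ h => graphCongruence_newVertex hiso hF ht l h₁ h₂ h
    | shift =>
      exact map_rel _ T T' hTT fun G₁ h₁ G₂ h₂ h => graphCongruence_relabel hiso hF _ h₁ h₂ h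
    | swap ht =>
      exact map_rel _ T T' hTT fun G₁ h₁ G₂ h₂ h => graphCongruence_relabel hiso hF _ h₁ h₂ h
    | glue => exact .none
  · intro a T T' U U' hTT hUU
    rw [valueClass_eq_iff] at hTT hUU ⊢
    cases a with
    | glue =>
      rw [value, value]
      rcases hT : value T with _ | G <;> rcases hT' : value T' with _ | G' <;>
        rw [hT, hT'] at hTT
      · exact .none
      · cases hTT
      · cases hTT
      rcases hU : value U with _ | K <;> rcases hU' : value U' with _ | K' <;>
        rw [hU, hU'] at hUU
      · exact .none
      · cases hUU
      · cases hUU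
      obtain ⟨hGG⟩ := hTT
      obtain ⟨hKK⟩ := hUU
      simp only [Option.bind_some]
      by_cases hc : G.Compatible K
      · rw [if_pos hc, if_pos (hGG.1.symm.trans (hc.trans hKK.1))]
        exact .some (graphCongruence_glue hiso hF (mem_USmall_of_value hT)
          (mem_USmall_of_value hT') (mem_USmall_of_value hU) (mem_USmall_of_value hU') hc hGG hKK)
      · rw [if_neg hc, if_neg fun hc' => hc (hGG.1.trans (hc'.trans hKK.1.symm))]
        exact .none
    | _ => exact .none
  · rintro T T' hTT ⟨G, hG, hT⟩
    rw [valueClass_eq_iff, hT] at hTT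
    rcases hT' : value T' with _ | G' <;> rw [hT'] at hTT
    · cases hTT
    · obtain ⟨hGG⟩ := hTT
      exact ⟨G', graphCongruence_mem hiso hF hGG hG, hT'⟩

theorem finiteIndexOver_of_recognizable (hiso : IsoClosed F) (hF : F ⊆ USmall t)
    (h : Recognizable (parseTrees F)) : FiniteIndexOver (graphCongruence F) (USmall t) := by
  obtain ⟨A, hA⟩ := h
  have := A.finite_Q
  have mem_iff : ∀ {T G}, value T = some G → (A.Accepts T ↔ G ∈ F) := by
    intro T G hT
    rw [hA]
    constructor
    · rintro ⟨G', hG', hT'⟩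
      rwa [Option.some.inj (hT.symm.trans hT')]
    · exact fun hG => ⟨G, hG, hT⟩
  choose T K hT hK using fun G : USmall t => G.2
  refine FiniteIndexOver.of_map
    (fun G => (A.state (T G), fun i => G.1.color (G.1.lab i))) fun G₁ G₂ h => ?_
  obtain ⟨hstate, hcol⟩ := Prod.mk.inj h
  have hc : G₁.1.Compatible G₂.1 := fun i => congrFun hcol i
  refine ⟨hc, fun H h₁ h₂ => ?_⟩
  by_cases hH : H ∈ USmall t
  · have key : ∀ G : USmall t, G.1.Compatible H →
        (G.1.glue H ∈ F ↔ A.Accepts (.binary .glue (T G) (T ⟨H, hH⟩))) := by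
      intro G hGH
      rw [hiso.mem_iff_of_labIso hF ((hK G).glue (hK ⟨H, hH⟩) hGH),
        mem_iff (value_glue (hT G) (hT ⟨H, hH⟩)
          ((hK G).symm.compatible.trans (hGH.trans (hK ⟨H, hH⟩).compatible)))]
    rw [key G₁ h₁, key G₂ h₂]
    simp only [TreeAutomaton.Accepts, TreeAutomaton.state, hstate]
  · exact ⟨fun hm => (hH (USmall.of_glue h₁ (hF hm))).elim,
      fun hm => (hH (USmall.of_glue h₂ (hF hm))).elim⟩

end GraphCongruence

/-! ### Hypergraphs and their incidence graphs -/

section Incidence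

variable {t : ℕ}

open BGraph

theorem Glued.snd_of_rel {A B : Type} {r : A → B → Prop}
    (hr : ∀ a a' b, r a b → r a' b → a = a') {a : A} {b : B} (h : r a b) :
    Glued.snd r b = Sum.inl a := by
  have hex : ∃ a, r a b := ⟨a, h⟩
  rw [Glued.snd, dif_pos hex, hr _ _ _ hex.choose_spec h]

theorem Glued.fst_eq_snd_iff {A B : Type} {r : A → B → Prop}
    (hr : ∀ a a' b, r a b → r a' b → a = a') {a : A} {b : B} :
    Glued.fst r a = Glued.snd r b ↔ r a b := by
  refine ⟨fun h => ?_, fun h => (Glued.snd_of_rel hr h).symm⟩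
  by_cases hex : ∃ a, r a b
  · obtain ⟨a', ha'⟩ := hex
    rw [Glued.snd_of_rel hr ha'] at h
    rwa [Sum.inl_injective h]
  · rw [Glued.snd, dif_neg hex] at h
    exact absurd h Sum.inl_ne_inr

theorem Glued.exists_fst_or_snd {A B : Type} (r : A → B → Prop) (x : Glued A B r) :
    (∃ a, Glued.fst r a = x) ∨ ∃ b, Glued.snd r b = x := by
  rcases x with a | ⟨b, hb⟩
  · exact .inl ⟨a, rfl⟩
  · exact .inr ⟨b, dif_neg (not_exists.2 hb)⟩

namespace BHyper

theorem sameLabelV_left_unique {H K : BHyper t} (v v' : H.V) (w : K.V)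
    (h : H.SameLabelV K v w) (h' : H.SameLabelV K v' w) : v = v' := by
  obtain ⟨i, hi, hi'⟩ := h
  obtain ⟨j, hj, hj'⟩ := h'
  obtain rfl := K.lab.injective (hi'.trans hj'.symm)
  exact Sum.inl_injective (hi.symm.trans hj)

theorem sameLabelV_right_unique {H K : BHyper t} (v : H.V) (w w' : K.V)
    (h : H.SameLabelV K v w) (h' : H.SameLabelV K v w') : w = w' := by
  obtain ⟨i, hi, hi'⟩ := h
  obtain ⟨j, hj, hj'⟩ := h'
  obtain rfl := H.lab.injective (hi.trans hj.symm)
  exact Sum.inl_injective (hi'.symm.trans hj')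

theorem sameLabelE_left_unique {H K : BHyper t} (d d' : H.E) (e : K.E)
    (h : H.SameLabelE K d e) (h' : H.SameLabelE K d' e) : d = d' := by
  obtain ⟨i, hi, hi'⟩ := h
  obtain ⟨j, hj, hj'⟩ := h'
  obtain rfl := K.lab.injective (hi'.trans hj'.symm)
  exact Sum.inr_injective (hi.symm.trans hj)

theorem sameLabelE_right_unique {H K : BHyper t} (d : H.E) (e e' : K.E)
    (h : H.SameLabelE K d e) (h' : H.SameLabelE K d e') : e = e' := by
  obtain ⟨i, hi, hi'⟩ := h
  obtain ⟨j, hj, hj'⟩ := h'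
  obtain rfl := H.lab.injective (hi.trans hj.symm)
  exact Sum.inr_injective (hi'.symm.trans hj')

/-- The incidence graph of a hypergraph: its vertices, of color 1, and its hyperedges, of color 2,
with an edge between a hyperedge and each of its elements. -/
def incidence (H : BHyper t) : BGraph t where
  V := H.V ⊕ H.E
  finite_V := by
    have := H.finite_V
    have := H.finite_E
    infer_instance
  graph := SimpleGraph.fromRel fun x y => ∃ v e, x = Sum.inl v ∧ y = Sum.inr e ∧ v ∈ H.edge e
  color := Sum.elim (fun _ => Color.one) fun _ => Color.two
  lab := H.lab

theorem incidence_adj (H : BHyper t) (x y : H.V ⊕ H.E) :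
    H.incidence.graph.Adj x y ↔ ∃ v e, v ∈ H.edge e ∧
      (x = Sum.inl v ∧ y = Sum.inr e ∨ x = Sum.inr e ∧ y = Sum.inl v) := by
  refine (SimpleGraph.fromRel_adj _ _ _).trans ⟨?_, ?_⟩
  · rintro ⟨-, ⟨v, e, hx, hy, h⟩ | ⟨v, e, hy, hx, h⟩⟩
    · exact ⟨v, e, h, .inl ⟨hx, hy⟩⟩
    · exact ⟨v, e, h, .inr ⟨hx, hy⟩⟩
  · rintro ⟨v, e, h, ⟨rfl, rfl⟩ | ⟨rfl, rfl⟩⟩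
    · exact ⟨Sum.inl_ne_inr, .inl ⟨v, e, rfl, rfl, h⟩⟩
    · exact ⟨Sum.inr_ne_inl, .inr ⟨v, e, rfl, rfl, h⟩⟩

theorem incidence_adj_inl_inr {H : BHyper t} {v : H.V} {e : H.E} :
    H.incidence.graph.Adj (Sum.inl v : H.V ⊕ H.E) (Sum.inr e : H.V ⊕ H.E) ↔ v ∈ H.edge e := by
  rw [incidence_adj]
  simp

theorem not_incidence_adj_inl_inl {H : BHyper t} {v w : H.V} :
    ¬ H.incidence.graph.Adj (Sum.inl v : H.V ⊕ H.E) (Sum.inl w : H.V ⊕ H.E) := by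
  rw [incidence_adj]
  simp

theorem not_incidence_adj_inr_inr {H : BHyper t} {d e : H.E} :
    ¬ H.incidence.graph.Adj (Sum.inr d : H.V ⊕ H.E) (Sum.inr e : H.V ⊕ H.E) := by
  rw [incidence_adj]
  simp

theorem isIncidence_incidence (H : BHyper t) : H.incidence.IsIncidence := by
  intro x y hxy
  obtain ⟨v, e, -, ⟨rfl, rfl⟩ | ⟨rfl, rfl⟩⟩ := (incidence_adj H x y).1 hxy
  · exact Color.noConfusion
  · exact Color.noConfusion

theorem compatible_incidence {H K : BHyper t} :
    H.incidence.Compatible K.incidence ↔ H.Gluable K := by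
  refine forall_congr' fun i => ?_
  change Sum.elim (fun _ => Color.one) (fun _ => Color.two) (H.lab i) =
    Sum.elim (fun _ => Color.one) (fun _ => Color.two) (K.lab i) ↔ _
  rcases H.lab i with v | d <;> rcases K.lab i with w | e <;> simp

theorem LabIso.incidence {H K : BHyper t} (h : H.LabIso K) : H.incidence.LabIso K.incidence := by
  obtain ⟨f, g, he, hl⟩ := h
  refine ⟨⟨Equiv.sumCongr f g, ?_⟩, ?_, hl⟩
  · have mem_iff : ∀ v e, f v ∈ K.edge (g e) ↔ v ∈ H.edge e := fun v e => by
      rw [he, f.injective.mem_set_image]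
    rintro (v | d) (w | e)
    · exact iff_of_false not_incidence_adj_inl_inl not_incidence_adj_inl_inl
    · exact incidence_adj_inl_inr.trans ((mem_iff v e).trans incidence_adj_inl_inr.symm)
    · refine (K.incidence.graph.adj_comm _ _).trans (Iff.trans ?_ (H.incidence.graph.adj_comm _ _))
      exact incidence_adj_inl_inr.trans ((mem_iff w d).trans incidence_adj_inl_inr.symm)
    · exact iff_of_false not_incidence_adj_inr_inr not_incidence_adj_inr_inr
  · rintro (v | e) <;> rfl

/-- Taking incidence graphs commutes with gluing. -/
theorem incidence_glue {H K : BHyper t} (h : H.Gluable K) :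
    (H.incidence.glue K.incidence).LabIso (H.glue K).incidence := by
  let f : H.V ⊕ H.E → (H.glue K).V ⊕ (H.glue K).E := Sum.map (Glued.fst _) (Glued.fst _)
  let g : K.V ⊕ K.E → (H.glue K).V ⊕ (H.glue K).E := Sum.map (Glued.snd _) (Glued.snd _)
  have mem_edge : ∀ x y, x ∈ (H.glue K).edge y ↔
      (∃ v d, v ∈ H.edge d ∧ Glued.fst _ v = x ∧ Glued.fst _ d = y) ∨
      ∃ w e, w ∈ K.edge e ∧ Glued.snd _ w = x ∧ Glued.snd _ e = y := by
    intro x y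
    constructor
    · rintro (⟨d, hd, v, hv, hx⟩ | ⟨e, he, w, hw, hx⟩)
      · exact .inl ⟨v, d, hv, hx, hd⟩
      · exact .inr ⟨w, e, hw, hx, he⟩
    · rintro (⟨v, d, hv, hx, hd⟩ | ⟨w, e, hw, hx, he⟩)
      · exact .inl ⟨d, hd, v, hv, hx⟩
      · exact .inr ⟨e, he, w, hw, hx⟩
  have hG : IsGluing H.incidence K.incidence (H.glue K).incidence f g :=
    { injective_fst := (Glued.fst _).injective.sumMap (Glued.fst _).injective
      injective_snd := (Glued.snd_injective _ sameLabelV_right_unique).sumMap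
        (Glued.snd_injective _ sameLabelE_right_unique)
      eq_iff := by
        rintro (v | d) (w | e)
        · exact Sum.inl_injective.eq_iff.trans (Glued.fst_eq_snd_iff sameLabelV_left_unique)
        · refine ⟨fun h => absurd h Sum.inl_ne_inr, fun ⟨i, hi, hi'⟩ => ?_⟩
          exact ((h i).1 ⟨congrArg Sum.isLeft hi, congrArg Sum.isRight hi'⟩).elim
        · refine ⟨fun h => absurd h Sum.inr_ne_inl, fun ⟨i, hi, hi'⟩ => ?_⟩
          exact ((h i).2 ⟨congrArg Sum.isRight hi, congrArg Sum.isLeft hi'⟩).elim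
        · exact Sum.inr_injective.eq_iff.trans (Glued.fst_eq_snd_iff sameLabelE_left_unique)
      surj := by
        rintro (x | y)
        · obtain ⟨v, rfl⟩ | ⟨w, rfl⟩ := Glued.exists_fst_or_snd _ x
          · exact .inl ⟨Sum.inl v, rfl⟩
          · exact .inr ⟨Sum.inl w, rfl⟩
        · obtain ⟨d, rfl⟩ | ⟨e, rfl⟩ := Glued.exists_fst_or_snd _ y
          · exact .inl ⟨Sum.inr d, rfl⟩
          · exact .inr ⟨Sum.inr e, rfl⟩
      map_fst := by
        intro x y hxy
        obtain ⟨v, d, hv, ⟨rfl, rfl⟩ | ⟨rfl, rfl⟩⟩ := (incidence_adj H x y).1 hxy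
        · exact incidence_adj_inl_inr.2 ((mem_edge _ _).2 (.inl ⟨v, d, hv, rfl, rfl⟩))
        · exact (incidence_adj_inl_inr.2 ((mem_edge _ _).2 (.inl ⟨v, d, hv, rfl, rfl⟩))).symm
      map_snd := by
        intro x y hxy
        obtain ⟨w, e, hw, ⟨rfl, rfl⟩ | ⟨rfl, rfl⟩⟩ := (incidence_adj K x y).1 hxy
        · exact incidence_adj_inl_inr.2 ((mem_edge _ _).2 (.inr ⟨w, e, hw, rfl, rfl⟩))
        · exact (incidence_adj_inl_inr.2 ((mem_edge _ _).2 (.inr ⟨w, e, hw, rfl, rfl⟩))).symm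
      adj := by
        intro x y hxy
        obtain ⟨u, c, hu, hxy⟩ := (incidence_adj (H.glue K) x y).1 hxy
        obtain ⟨v, d, hv, rfl, rfl⟩ | ⟨w, e, hw, rfl, rfl⟩ := (mem_edge _ _).1 hu
        · have hvd := incidence_adj_inl_inr.2 hv
          obtain ⟨rfl, rfl⟩ | ⟨rfl, rfl⟩ := hxy
          · exact .inl ⟨_, _, hvd, rfl, rfl⟩
          · exact .inl ⟨_, _, hvd.symm, rfl, rfl⟩
        · have hwe := incidence_adj_inl_inr.2 hw
          obtain ⟨rfl, rfl⟩ | ⟨rfl, rfl⟩ := hxy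
          · exact .inr ⟨_, _, hwe, rfl, rfl⟩
          · exact .inr ⟨_, _, hwe.symm, rfl, rfl⟩
      color_fst := by rintro (v | d) <;> rfl
      color_snd := by rintro (w | e) <;> rfl }
  exact hG.labIso fun _ => rfl

theorem labIso_toHyper_incidence (H : BHyper t) : H.LabIso H.incidence.toHyper := by
  let f : H.V → H.incidence.toHyper.V := fun v => ⟨Sum.inl v, rfl⟩
  let g : H.E → H.incidence.toHyper.E := fun e => ⟨Sum.inr e, Color.noConfusion⟩
  have hf : Function.Bijective f := by
    refine ⟨fun v w h => Sum.inl_injective (congrArg Subtype.val h), ?_⟩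
    rintro ⟨v | e, h⟩
    · exact ⟨v, rfl⟩
    · exact Color.noConfusion h
  have hg : Function.Bijective g := by
    refine ⟨fun v w h => Sum.inr_injective (congrArg Subtype.val h), ?_⟩
    rintro ⟨v | e, h⟩
    · exact (h rfl).elim
    · exact ⟨e, rfl⟩
  refine ⟨Equiv.ofBijective f hf, Equiv.ofBijective g hg, fun e => ?_, fun i => ?_⟩
  · have mem_iff : ∀ v, f v ∈ H.incidence.toHyper.edge (g e) ↔ v ∈ H.edge e := fun v =>
      (H.incidence.graph.adj_comm _ _).trans incidence_adj_inl_inr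
    ext x
    obtain ⟨v, rfl⟩ := hf.2 x
    exact (mem_iff v).trans hf.1.mem_set_image.symm
  · let c := Equiv.sumCompl fun v : H.incidence.V => H.incidence.color v = Color.one
    have hc : ∀ x : H.V ⊕ H.E, c (Sum.map f g x) = x := by rintro (v | e) <;> rfl
    exact (c.symm_apply_eq.2 (hc (H.lab i)).symm).symm

end BHyper

namespace BGraph

theorem Iso.toHyper {G K : BGraph t} (h : G.Iso K) : G.toHyper.Iso K.toHyper := by
  obtain ⟨φ, hφ⟩ := h
  refine ⟨φ.toEquiv.subtypeEquiv fun v => by rw [← hφ v]; rfl,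
    φ.toEquiv.subtypeEquiv fun v => by rw [← hφ v]; rfl, fun e => ?_⟩
  ext x
  obtain ⟨v, rfl⟩ := (φ.toEquiv.subtypeEquiv (p := fun v => G.color v = Color.one)
    (q := fun v => K.color v = Color.one) fun v => by rw [← hφ v]; rfl).surjective x
  refine Iff.trans ?_ (Equiv.injective _).mem_set_image.symm
  exact φ.map_adj_iff

theorem IsIncidence.labIso_incidence_toHyper {G : BGraph t} (hG : G.IsIncidence) :
    G.LabIso G.toHyper.incidence := by
  refine LabIso.symm ⟨⟨Equiv.sumCompl fun v => G.color v = Color.one, ?_⟩, ?_, ?_⟩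
  · have hne : ∀ {v w}, (G.color v = Color.one ↔ G.color w = Color.one) → ¬ G.graph.Adj v w := by
      intro v w h hvw
      have := hG v w hvw
      cases hv : G.color v <;> cases hw : G.color w <;> simp_all
    rintro (v | d) (w | e)
    · exact iff_of_false (hne (iff_of_true v.2 w.2)) BHyper.not_incidence_adj_inl_inl
    · exact (G.graph.adj_comm _ _).trans
        (BHyper.incidence_adj_inl_inr (H := G.toHyper) (v := v) (e := e)).symm
    · exact (BHyper.incidence_adj_inl_inr (H := G.toHyper) (v := w) (e := d)).symm.trans
        (G.toHyper.incidence.graph.adj_comm _ _)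
    · exact iff_of_false (hne (iff_of_false d.2 e.2)) BHyper.not_incidence_adj_inr_inr
  · rintro (v | d)
    · exact v.2
    · change G.color d.1 = Color.two
      cases h : G.color d.1
      · exact absurd h d.2
      · rfl
  · intro i
    exact (Equiv.sumCompl _).apply_symm_apply (G.lab i)

theorem IsIncidence.of_glue {G H : BGraph t} (h : G.Compatible H) (hGH : (G.glue H).IsIncidence) :
    H.IsIncidence := by
  have hX := isGluing_glue h
  intro v w hvw
  rw [← hX.color_snd, ← hX.color_snd]
  exact hGH _ _ (hX.map_snd hvw)

theorem IsIncidence.of_glue_left {G H : BGraph t} (h : G.Compatible H)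
    (hGH : (G.glue H).IsIncidence) : G.IsIncidence :=
  of_glue h.symm ((glue_comm h).iso.isIncidence hGH)

end BGraph

variable {F : Set (BGraph t)}

theorem mem_hyperOf_iff (hclosed : ∀ {G K : BGraph t}, G.LabIso K → (G ∈ F ↔ K ∈ F))
    {H : BHyper t} : H ∈ hyperOf F ↔ H.incidence ∈ F := by
  constructor
  · rintro ⟨G, hG, hinc, hH⟩
    exact (hclosed (hH.incidence.trans hinc.labIso_incidence_toHyper.symm)).2 hG
  · exact fun h => ⟨_, h, H.isIncidence_incidence, H.labIso_toHyper_incidence⟩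

theorem mem_HSmall_iff {H : BHyper t} : H ∈ HSmall t ↔ H.incidence ∈ USmall t :=
  mem_hyperOf_iff fun h => ⟨fun hG => USmall.of_labIso hG h.symm, fun hK => USmall.of_labIso hK h⟩

/-- The canonical congruences of a hypergraph problem and of the set of its incidence graphs
correspond. Contexts that are not incidence graphs do not matter for the latter. -/
theorem hyperCongruence_iff (hclosed : ∀ {G K : BGraph t}, G.LabIso K → (G ∈ F ↔ K ∈ F))
    (hinc : ∀ G ∈ F, G.IsIncidence) {H₁ H₂ : BHyper t} :
    hyperCongruence (hyperOf F) H₁ H₂ ↔ graphCongruence F H₁.incidence H₂.incidence := by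
  have key : ∀ {H K : BHyper t}, H.Gluable K →
      (H.glue K ∈ hyperOf F ↔ H.incidence.glue K.incidence ∈ F) := fun h => by
    rw [mem_hyperOf_iff hclosed, hclosed (BHyper.incidence_glue h)]
  constructor
  · rintro ⟨hg, h⟩
    refine ⟨BHyper.compatible_incidence.2 hg, fun X h₁ h₂ => ?_⟩
    by_cases hX : X.IsIncidence
    · have hX' := hX.labIso_incidence_toHyper
      have hg₁ := BHyper.compatible_incidence.1 (h₁.trans hX'.compatible)
      have hg₂ := BHyper.compatible_incidence.1 (h₂.trans hX'.compatible)
      rw [hclosed ((LabIso.refl _).glue hX' h₁), hclosed ((LabIso.refl _).glue hX' h₂),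
        ← key hg₁, ← key hg₂]
      exact h _ hg₁ hg₂
    · exact ⟨fun hm => (hX (.of_glue h₁ (hinc _ hm))).elim,
        fun hm => (hX (.of_glue h₂ (hinc _ hm))).elim⟩
  · rintro ⟨hc, h⟩
    refine ⟨BHyper.compatible_incidence.1 hc, fun K h₁ h₂ => ?_⟩
    rw [key h₁, key h₂]
    exact h _ (BHyper.compatible_incidence.2 h₁) (BHyper.compatible_incidence.2 h₂)

theorem finiteIndexOver_hyper_iff (hiso : IsoClosed F) (hF : F ⊆ USmall t)
    (hinc : ∀ G ∈ F, G.IsIncidence) :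
    FiniteIndexOver (hyperCongruence (hyperOf F)) (HSmall t) ↔
      FiniteIndexOver (graphCongruence F) (USmall t) := by
  have hclosed : ∀ {G K : BGraph t}, G.LabIso K → (G ∈ F ↔ K ∈ F) :=
    hiso.mem_iff_of_labIso hF
  constructor
  · intro h
    have : Finite _ := h
    classical
    have mem : ∀ G : USmall t, G.1.IsIncidence → G.1.toHyper ∈ HSmall t := fun G hG =>
      ⟨G.1, G.2, hG, Equiv.refl _, Equiv.refl _, by simp, by simp⟩
    -- Graphs that are not incidence graphs are told apart by the colors of their boundaries only.
    refine FiniteIndexOver.of_map (fun G : USmall t =>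
      ((fun i => G.1.color (G.1.lab i)), if hG : G.1.IsIncidence then
        some (Quotient.mk ((hyperCongruence (hyperOf F)).comap (Subtype.val : HSmall t → BHyper t))
          ⟨G.1.toHyper, mem G hG⟩) else none)) fun G₁ G₂ hGG => ?_
    obtain ⟨hcol, hcls⟩ := Prod.mk.inj hGG
    have hc : G₁.1.Compatible G₂.1 := fun i => congrFun hcol i
    by_cases h₁ : G₁.1.IsIncidence <;> by_cases h₂ : G₂.1.IsIncidence
    · rw [dif_pos h₁, dif_pos h₂] at hcls
      have hH := Quotient.exact (Option.some_injective _ hcls)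
      have e₁ := graphCongruence_of_labIso hiso hF h₁.labIso_incidence_toHyper
      have e₂ := graphCongruence_of_labIso hiso hF h₂.labIso_incidence_toHyper.symm
      exact (graphCongruence F).trans e₁ ((graphCongruence F).trans
        ((hyperCongruence_iff hclosed hinc).1 hH) e₂)
    · simp [h₁, h₂] at hcls
    · simp [h₁, h₂] at hcls
    · exact ⟨hc, fun H hH₁ hH₂ => ⟨fun hm => (h₁ (.of_glue_left hH₁ (hinc _ hm))).elim,
        fun hm => (h₂ (.of_glue_left hH₂ (hinc _ hm))).elim⟩⟩
  · intro h
    have : Finite _ := h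
    refine FiniteIndexOver.of_map (fun H : HSmall t =>
      Quotient.mk ((graphCongruence F).comap (Subtype.val : USmall t → BGraph t))
        ⟨H.1.incidence, mem_HSmall_iff.1 H.2⟩) fun H₁ H₂ hHH => ?_
    have hG := Quotient.exact hHH
    exact (hyperCongruence_iff hclosed hinc).2 hG

/-- Isomorphic generated incidence graphs represent isomorphic hypergraphs, so a set of incidence
graphs inherits the invariance of the hypergraph problem that it represents. -/
theorem isoClosed_of_generatorTotal
    (hiso : ∀ H ∈ hyperOf F, ∀ K ∈ HSmall t, H.Iso K → K ∈ hyperOf F)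
    (hinc : ∀ G ∈ F, G.IsIncidence) (htotal : GeneratorTotal F) : IsoClosed F := by
  intro G hG K hK hGK
  have refl : ∀ H : BHyper t, H.LabIso H := fun H => ⟨Equiv.refl _, Equiv.refl _, by simp, by simp⟩
  have hKinc := hGK.isIncidence (hinc G hG)
  exact htotal K hK hKinc (hiso _ ⟨G, hG, hinc G hG, refl _⟩ _ ⟨K, hK, hKinc, refl _⟩ hGK.toHyper)

end Incidence

end HyperMN
open HyperMN in
theorem theorem3 (t : ℕ) (𝓕 : Set (BHyper t)) (h𝓕 : 𝓕 ⊆ HSmall t)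
    (hiso : ∀ H ∈ 𝓕, ∀ K ∈ HSmall t, H.Iso K → K ∈ 𝓕)
    (F : Set (BGraph t)) (hF : F ⊆ USmall t) (hinc : ∀ G ∈ F, G.IsIncidence)
    (htotal : GeneratorTotal F) (hrep : 𝓕 = hyperOf F) :
    List.TFAE [
      Recognizable (parseTrees F),
      FiniteIndexOver (hyperCongruence 𝓕) (HSmall t),
      FiniteIndexOver (graphCongruence F) (USmall t)] := by
  subst hrep
  have hclosed := isoClosed_of_generatorTotal hiso hinc htotal
  tfae_have 1 → 3 := finiteIndexOver_of_recognizable hclosed hF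
  tfae_have 3 → 1 := recognizable_of_finiteIndexOver hclosed hF
  tfae_have 2 ↔ 3 := finiteIndexOver_hyper_iff hclosed hF hinc
  tfae_finish
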